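/- Let $\Gamma$ be a finite, undirected, connected distance-regular graph without loops or multiple edges, with vertex set $X$, diameter $D\ge 3$ and valency $k\ge 3$. Let $A$ be its adjacency matrix, and let $M\subseteq \mathrm{Mat}_X(\mathbb C)$ be its Bose–Mesner algebra. Let $E_0=|X|^{-1}J,E_1,\dots,E_D$ (with $J$ the all-ones matrix) be an ordering of the primitive idempotents of $M$ with respect to which $\Gamma$ is $Q$-polynomial: if the Krein parameters $q^h_{ij}$ are defined by $E_i\circ E_j=|X|^{-1}\sum_h q^h_{ij}E_h$ (entrywise product), then for $0\le h,i,j\le D$ we have $q^h_{ij}=0$ if one of $h,i,j$ is greater than the sum of the other two, and $q^h_{ij}\ne 0$ if one of them is equal to the sum of the other two. Fix $x\in X$. Let $E^*_i$ $(0\le i\le D)$ be the diagonal matrix with $(y,y)$-entry $1$ if $\partial(x,y)=i$ and $0$ otherwise, and let $A^*$ be the diagonal matrix with $(y,y)$-entry $|X|(E_1)_{xy}$. Write $A=\sum_i\theta_iE_i$ and $A^*=\sum_i\theta^*_iE^*_i$. Let $T=T(x)$ be the subalgebra of $\mathrm{Mat}_X(\mathbb C)$ generated by $M$ and $E^*_0,\dots,E^*_D$.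 A $T$-module is a subspace $W\subseteq\mathbb C^X$ with $TW\subseteq W$. It is irreducible if $W\neq0$ and its only $T$-submodules are $0$ and $W$, and thin if $\dim E^*_iW\le1$ for all $i$. An isomorphism of $T$-modules is a linear isomorphism that commutes with the action of $T$. The endpoint of $W$ is $r=\min\{i: E^*_iW\ne0\}$, its dual endpoint is $t=\min\{i:E_iW\neq0\}$, and its diameter is $d=|\{i:E^*_iW\ne0\}|-1$. For a thin irreducible $T$-module $W$ with endpoint $r$, dual endpoint $t$ and diameter $d$, put $a_i(W)=\mathrm{tr}_W(E^*_{r+i}A)$ and $a^*_i(W)=\mathrm{tr}_W(E_{t+i}A^*)$ for $0\le i\le d$. For $1\le i\le d$ let $\varphi_i(W)$ be the eigenvalue of $(A-\theta_{t+i-1}I)(A^*-\theta^*_{r+i}I)$ on the one-dimensional space $\prod_{h=0}^{i-1}(A-\theta_{t+h}I)\,E^*_rW$, and let $\phi_i(W)$ be the eigenvalue of $(A-\theta_{t+d-i+1}I)(A^*-\theta^*_{r+i}I)$ on the one-dimensional space $\prod_{h=0}^{i-1}(A-\theta_{t+d-h}I)\,E^*_rW$. **Theorem.** Let $W$ and $W'$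 be thin irreducible $T$-modules with common diameter $d$. (i) Assume $d=0$. Then $W$ and $W'$ are isomorphic as $T$-modules if and only if they have the same endpoint and the same dual endpoint. (ii) Assume $d>0$. Then $W$ and $W'$ are isomorphic as $T$-modules if and only if they have the same endpoint, the same dual endpoint, and the same values of all eight scalars $$\varphi_1,\quad \varphi_d,\quad \phi_1,\quad \phi_d,\quad a_0,\quad a_d,\quad a^*_0,\quad a^*_d .$$ Moreover, if $W$ and $W'$ have the same endpoint and the same dual endpoint, then the eight equalities $\varphi_1(W)=\varphi_1(W')$, …, $a^*_d(W)=a^*_d(W')$ are equivalent to each other. Consequently, for each single one $f$ of the eight scalars, $W$ and $W'$ are isomorphic if and only if they have the same endpoint, the same dual endpoint, and $f(W)=f(W')$. -/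

import Mathlib

noncomputable section

namespace DRG

variable {V : Type*} [Fintype V] [DecidableEq V]

/-! ### Distance-regular graphs and the Bose-Mesner algebra -/

/-- A connected graph is distance-regular if `|Γ_i(y) ∩ Γ_j(z)|` depends only on `i`, `j` and
the distance of `y` and `z`. -/
structure IsDistanceRegular (G : SimpleGraph V) : Prop where
  connected : G.Connected
  exists_intersectionNumbers : ∃ p : ℕ → ℕ → ℕ → ℕ, ∀ (y z : V) (i j : ℕ),
    {w : V | G.dist y w = i ∧ G.dist z w = j}.ncard = p (G.dist y z) i j

/-- The `i`-th distance matrix `A_i` (it is `0` when `i` exceeds the diameter). -/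
def distMatrix (G : SimpleGraph V) (i : ℕ) : Matrix V V ℂ :=
  Matrix.of fun y z => if G.dist y z = i then 1 else 0

/-- The adjacency matrix `A = A_1`. -/
def adj (G : SimpleGraph V) : Matrix V V ℂ := distMatrix G 1

/-- The Bose-Mesner algebra `M`, as the span of the distance matrices. -/
def boseMesner (G : SimpleGraph V) : Submodule ℂ (Matrix V V ℂ) :=
  Submodule.span ℂ (Set.range (distMatrix G))

/-- `E_0, …, E_D` is an ordering of the primitive idempotents of `G`, where `D` is the diameter
of `G`, with `E_0 = |V|⁻¹ J`. The matrices `E i` with `i > D` play no role. -/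
structure IsIdempotentOrdering (G : SimpleGraph V) (E : ℕ → Matrix V V ℂ) : Prop where
  linearIndependent : LinearIndependent ℂ fun i : Fin (G.diam + 1) => E i
  span_eq : Submodule.span ℂ (E '' Set.Iic G.diam) = boseMesner G
  zero_eq : E 0 = (Fintype.card V : ℂ)⁻¹ • Matrix.of fun _ _ => 1
  sum_eq : ∑ i ∈ Finset.range (G.diam + 1), E i = 1
  transpose_eq : ∀ i ≤ G.diam, (E i).transpose = E i
  conj_eq : ∀ i ≤ G.diam, (E i).map (starRingEnd ℂ) = E i
  mul_eq : ∀ i ≤ G.diam, ∀ j ≤ G.diam, E i * E j = if i = j then E i else 0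

/-- `G` is `Q`-polynomial with respect to the ordering `E_0, …, E_D` of its primitive idempotents.
The scalars `q h i j` are the Krein parameters `q^h_{ij}`. -/
def IsQPolynomial (G : SimpleGraph V) (E : ℕ → Matrix V V ℂ) : Prop :=
  ∃ q : ℕ → ℕ → ℕ → ℂ,
    (∀ i ≤ G.diam, ∀ j ≤ G.diam, Matrix.hadamard (E i) (E j) =
      (Fintype.card V : ℂ)⁻¹ • ∑ h ∈ Finset.range (G.diam + 1), q h i j • E h) ∧
    ∀ h ≤ G.diam, ∀ i ≤ G.diam, ∀ j ≤ G.diam,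
      ((i + j < h ∨ h + j < i ∨ h + i < j) → q h i j = 0) ∧
      ((h = i + j ∨ i = h + j ∨ j = h + i) → q h i j ≠ 0)

/-! ### The dual Bose-Mesner algebra and the Terwilliger algebra -/

/-- The `i`-th dual primitive idempotent `E*_i` with respect to `x`. -/
def dualIdempotent (G : SimpleGraph V) (x : V) (i : ℕ) : Matrix V V ℂ :=
  Matrix.diagonal fun y => if G.dist x y = i then 1 else 0

/-- The dual Bose-Mesner algebra `M*` with respect to `x`. -/
def dualBoseMesner (G : SimpleGraph V) (x : V) : Submodule ℂ (Matrix V V ℂ) :=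
  Submodule.span ℂ (Set.range (dualIdempotent G x))

/-- The dual adjacency matrix `A* = A*_1` with respect to `x`. -/
def dualAdj (x : V) (E : ℕ → Matrix V V ℂ) : Matrix V V ℂ :=
  Matrix.diagonal fun y => (Fintype.card V : ℂ) * E 1 x y

/-- The Terwilliger algebra `T(x)`, generated by `M` and `M*`. -/
def terwilliger (G : SimpleGraph V) (x : V) : Subalgebra ℂ (Matrix V V ℂ) :=
  Algebra.adjoin ℂ ((boseMesner G : Set (Matrix V V ℂ)) ∪ dualBoseMesner G x)

/-! ### `T`-modules -/

/-- `BW`, the image of the subspace `W` of the standard module under the matrix `B`. -/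
def img (B : Matrix V V ℂ) (W : Submodule ℂ (V → ℂ)) : Submodule ℂ (V → ℂ) :=
  W.map B.mulVecLin

/-- `W` is a `T`-module: `TW ⊆ W`. -/
def IsTModule (G : SimpleGraph V) (x : V) (W : Submodule ℂ (V → ℂ)) : Prop :=
  ∀ B ∈ terwilliger G x, ∀ w ∈ W, B.mulVec w ∈ W

/-- `W` is a thin irreducible `T`-module. -/
structure IsThinIrreducible (G : SimpleGraph V) (x : V) (W : Submodule ℂ (V → ℂ)) : Prop where
  isTModule : IsTModule G x W
  ne_bot : W ≠ ⊥
  irreducible : ∀ U : Submodule ℂ (V → ℂ), U ≤ W → IsTModule G x U → U = ⊥ ∨ U = W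
  thin : ∀ i ≤ G.diam, Module.finrank ℂ (img (dualIdempotent G x i) W) ≤ 1

/-- `W` and `W'` are isomorphic `T`-modules: some linear isomorphism `σ` from `W` to `W'`
satisfies `σ (B w) = B (σ w)` for all `B ∈ T` and `w ∈ W`. -/
def Iso (G : SimpleGraph V) (x : V) (W W' : Submodule ℂ (V → ℂ)) : Prop :=
  ∃ σ : W ≃ₗ[ℂ] W', ∀ B ∈ terwilliger G x, ∀ w w₁ : W,
    (w₁ : V → ℂ) = B.mulVec w → (σ w₁ : V → ℂ) = B.mulVec (σ w)

/-- The endpoint `r` of `W`. -/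
def endpoint (G : SimpleGraph V) (x : V) (W : Submodule ℂ (V → ℂ)) : ℕ :=
  sInf {i | i ≤ G.diam ∧ img (dualIdempotent G x i) W ≠ ⊥}

/-- The dual endpoint `t` of `W`. -/
def dualEndpoint (G : SimpleGraph V) (E : ℕ → Matrix V V ℂ) (W : Submodule ℂ (V → ℂ)) : ℕ :=
  sInf {i | i ≤ G.diam ∧ img (E i) W ≠ ⊥}

/-- The diameter `d` of `W`. -/
def diameter (G : SimpleGraph V) (x : V) (W : Submodule ℂ (V → ℂ)) : ℕ :=
  {i | i ≤ G.diam ∧ img (dualIdempotent G x i) W ≠ ⊥}.ncard - 1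

/-! ### Eigenvalues and traces -/

/-- The eigenvalue of `B` corresponding to a nonzero subspace `U` on which `B` acts as a scalar. -/
def eigenvalueOn (B : Matrix V V ℂ) (U : Submodule ℂ (V → ℂ)) : ℂ :=
  Classical.epsilon fun c : ℂ => ∀ u ∈ U, B.mulVec u = c • u

theorem eigenvalueOn_eq {B : Matrix V V ℂ} {U : Submodule ℂ (V → ℂ)} (hU : U ≠ ⊥) {c : ℂ}
    (h : ∀ u ∈ U, B.mulVec u = c • u) : eigenvalueOn B U = c := by
  have h' : ∀ u ∈ U, B.mulVec u = eigenvalueOn B U • u :=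
    Classical.epsilon_spec (p := fun c : ℂ => ∀ u ∈ U, B.mulVec u = c • u) ⟨c, h⟩
  obtain ⟨u, hu, hne⟩ := U.exists_mem_ne_zero_of_ne_bot hU
  exact smul_left_injective ℂ hne ((h' u hu).symm.trans (h u hu))

open Classical in
/-- `tr_W(B)`, the trace of the action of `B` on a subspace `W` with `BW ⊆ W`. -/
def traceOn (W : Submodule ℂ (V → ℂ)) (B : Matrix V V ℂ) : ℂ :=
  if h : ∀ w ∈ W, B.mulVecLin w ∈ W then LinearMap.trace ℂ W (B.mulVecLin.restrict h) else 0

/-- The eigenvalue `θ_i` of `G` associated with `E_i`: the eigenvalue of `A` on `E_i V`. -/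
def theta (G : SimpleGraph V) (E : ℕ → Matrix V V ℂ) (i : ℕ) : ℂ :=
  eigenvalueOn (adj G) (img (E i) ⊤)

/-- The dual eigenvalue `θ*_i` associated with `E*_i`: the eigenvalue of `A*` on `E*_i V`. -/
def dualTheta (G : SimpleGraph V) (x : V) (E : ℕ → Matrix V V ℂ) (i : ℕ) : ℂ :=
  eigenvalueOn (dualAdj x E) (img (dualIdempotent G x i) ⊤)

/-! ### The scalars attached to a thin irreducible `T`-module -/

section Scalars

variable (G : SimpleGraph V) (x : V) (E : ℕ → Matrix V V ℂ) (W : Submodule ℂ (V → ℂ))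

/-- `a_i(W) = tr_W(E*_{r+i} A)`. -/
def aCoeff (i : ℕ) : ℂ :=
  traceOn W (dualIdempotent G x (endpoint G x W + i) * adj G)

/-- `a*_i(W) = tr_W(E_{t+i} A*)`. -/
def aDualCoeff (i : ℕ) : ℂ :=
  traceOn W (E (dualEndpoint G E W + i) * dualAdj x E)

/-- `τ_i = ∏_{h < i} (λ - θ_{t+h})`. -/
def tau (i : ℕ) : Polynomial ℂ :=
  ∏ h ∈ Finset.range i, (Polynomial.X - Polynomial.C (theta G E (dualEndpoint G E W + h)))

/-- `η_i = ∏_{h < i} (λ - θ_{t+d-h})`, for `i ≤ d`. -/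
def eta (i : ℕ) : Polynomial ℂ :=
  ∏ h ∈ Finset.range i,
    (Polynomial.X - Polynomial.C (theta G E (dualEndpoint G E W + diameter G x W - h)))

/-- `U_i = τ_i(A) E*_r W`. -/
def splitSpace (i : ℕ) : Submodule ℂ (V → ℂ) :=
  img (Polynomial.aeval (adj G) (tau G E W i)) (img (dualIdempotent G x (endpoint G x W)) W)

/-- `U_i^⇓ = η_i(A) E*_r W`. -/
def splitSpaceDown (i : ℕ) : Submodule ℂ (V → ℂ) :=
  img (Polynomial.aeval (adj G) (eta G x E W i)) (img (dualIdempotent G x (endpoint G x W)) W)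

/-- The first split sequence: for `1 ≤ i ≤ d`, `φ_i` (written `\varphi_i`) is the eigenvalue of
`(A - θ_{t+i-1} I)(A* - θ*_{r+i} I)` corresponding to `U_i`. -/
def firstSplit (i : ℕ) : ℂ :=
  eigenvalueOn
    ((adj G - theta G E (dualEndpoint G E W + i - 1) • (1 : Matrix V V ℂ)) *
      (dualAdj x E - dualTheta G x E (endpoint G x W + i) • (1 : Matrix V V ℂ)))
    (splitSpace G x E W i)

/-- The second split sequence: for `1 ≤ i ≤ d`, `ϕ_i` (written `\phi_i`) is the eigenvalue of
`(A - θ_{t+d-i+1} I)(A* - θ*_{r+i} I)` corresponding to `U_i^⇓`. -/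
def secondSplit (i : ℕ) : ℂ :=
  eigenvalueOn
    ((adj G - theta G E (dualEndpoint G E W + diameter G x W - i + 1) • (1 : Matrix V V ℂ)) *
      (dualAdj x E - dualTheta G x E (endpoint G x W + i) • (1 : Matrix V V ℂ)))
    (splitSpaceDown G x E W i)

end Scalars

end DRG

end

set_option linter.unusedSectionVars false

noncomputable section

namespace DRG

open Polynomial Module

/-! ### Systems of orthogonal idempotents diagonalizing an element -/

section Eigen

variable {R : Type*} [Ring R] [Algebra ℂ R]

/-! On a thin irreducible module `W` the actions of `A` and `A*` form a Leonard system. Pick `u ≠ 0`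
in `E*_r W`. Then `u` is cyclic for `A`, and the vectors `τ_i(A) u` form a basis in which `A` is
lower bidiagonal and `A*` is upper bidiagonal. The diagonals are the eigenvalues `θ_{t+i}` and
`θ*_{r+i}`, already known from `t`, `r`, `d` and the graph; the only remaining data are the entries
`φ_i` of `A*` (`split`). As `A` and `A*` generate `T`, these data determine `W` up to isomorphism.

All the `φ_i` are governed by one scalar. Since `A*` is tridiagonal on the `E_i`, `E_{t+d} A* p(A)
u` involves only the values of `p` at the last two eigenvalues, and `A* u = θ*_r u` fixes the
unknown coefficient in terms of `a*_d` (`last_apply_aeval`). Taking `p = τ_{i+1}` makes each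
`φ_{i+1}` an affine function of `a*_d` (`split_mul`). Hence `r`, `t`, `d` and `a*_d` classify the
modules (`iso_iff`), and for `d = 0` no scalar is needed.

Seven affine relations with nonzero slopes then link the eight scalars in a chain: `ϕ_d`, `a*_0`,
`φ_1`, `a_0`, `ϕ_1`, `a*_d`, `φ_d`, `a_d` (`scalar_relations`). The slopes are differences of
distinct eigenvalues or dual eigenvalues, so any one scalar may replace `a*_d`.

The graph supplies three facts: the `θ_i` are distinct by connectedness, the `θ*_i` are distinct
because `E_1` determines every `E_m` entrywise, and `E_i A* E_j = 0` for `|i - j| > 1` by the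
vanishing of `q^1_{ij}`. -/

theorem aeval_mul_of_mul_eq {A e : R} {c : ℂ} (h : A * e = c • e) (p : ℂ[X]) :
    aeval A p * e = p.eval c • e := by
  induction p using Polynomial.induction_on' with
  | add p q hp hq => simp [add_mul, add_smul, hp, hq]
  | monomial k a =>
    rw [aeval_monomial, eval_monomial, mul_assoc, ← Algebra.smul_def, mul_smul]
    congr 1
    induction k with
    | zero => simp
    | succ k ih => rw [pow_succ, mul_assoc, h, mul_smul_comm, ih, smul_smul, pow_succ, mul_comm]

/-- `E_0, …, E_n` are orthogonal idempotents with sum `1`, and `A E_i = s_i E_i` with mutually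
distinct `s_0, …, s_n`. -/
structure IsEigenSystem (n : ℕ) (A : R) (E : ℕ → R) (s : ℕ → ℂ) : Prop where
  mul_eq : ∀ i ≤ n, ∀ j ≤ n, E i * E j = if i = j then E i else 0
  sum_eq : ∑ i ∈ Finset.range (n + 1), E i = 1
  eig : ∀ i ≤ n, A * E i = s i • E i
  inj : ∀ i ≤ n, ∀ j ≤ n, s i = s j → i = j

namespace IsEigenSystem

variable {n : ℕ} {A : R} {E : ℕ → R} {s : ℕ → ℂ}

theorem eq_sum (h : IsEigenSystem n A E s) : A = ∑ i ∈ Finset.range (n + 1), s i • E i := by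
  conv_lhs => rw [← mul_one A, ← h.sum_eq, Finset.mul_sum]
  exact Finset.sum_congr rfl fun i hi => h.eig i (by grind)

theorem mul_eig (h : IsEigenSystem n A E s) {i : ℕ} (hi : i ≤ n) :
    E i * A = s i • E i := by
  conv_lhs => rw [h.eq_sum, Finset.mul_sum]
  rw [Finset.sum_eq_single_of_mem i (by grind)]
  · rw [mul_smul_comm, h.mul_eq i hi i hi, if_pos rfl]
  · intro j hj hji
    rw [mul_smul_comm, h.mul_eq i hi j (by grind), if_neg hji.symm, smul_zero]

theorem aeval_mul (h : IsEigenSystem n A E s) {i : ℕ} (hi : i ≤ n) (p : ℂ[X]) :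
    aeval A p * E i = p.eval (s i) • E i :=
  aeval_mul_of_mul_eq (h.eig i hi) p

theorem mul_aeval (h : IsEigenSystem n A E s) {i : ℕ} (hi : i ≤ n) (p : ℂ[X]) :
    E i * aeval A p = p.eval (s i) • E i := by
  rw [← h.aeval_mul hi]
  conv_rhs => rw [← mul_one (aeval A p * E i)]
  have hc : Commute (E i) A := by
    change E i * A = A * E i
    rw [h.mul_eig hi, h.eig i hi]
  rw [mul_one]
  induction p using Polynomial.induction_on' with
  | add p q hp hq => simp [add_mul, mul_add, hp, hq]
  | monomial k a =>
    rw [aeval_monomial, ← Algebra.smul_def, mul_smul_comm, smul_mul_assoc, (hc.pow_right k).eq]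

/-- Lagrange interpolation: the product of `X - s_j` over `j ≠ i` kills every eigenspace except the
one of `s_i`. -/
theorem mem_adjoin (h : IsEigenSystem n A E s) {i : ℕ} (hi : i ≤ n) :
    E i ∈ Algebra.adjoin ℂ {A} := by
  set p : ℂ[X] := ∏ j ∈ (Finset.range (n + 1)).erase i, (X - C (s j)) with hp
  have key : aeval A p = p.eval (s i) • E i := by
    conv_lhs => rw [← mul_one (aeval A p), ← h.sum_eq, Finset.mul_sum]
    rw [Finset.sum_eq_single_of_mem i (by grind)]
    · exact h.aeval_mul hi p
    · intro j hj hji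
      rw [h.aeval_mul (by grind), hp, eval_prod,
        Finset.prod_eq_zero (i := j) (by grind) (by simp), zero_smul]
  have hne : p.eval (s i) ≠ 0 := by
    rw [hp, eval_prod, Finset.prod_ne_zero_iff]
    intro j hj
    simp only [eval_sub, eval_X, eval_C]
    intro h0
    have := h.inj i hi j (by grind) (sub_eq_zero.mp h0)
    grind
  have : E i = (p.eval (s i))⁻¹ • aeval A p := by
    rw [key, smul_smul, inv_mul_cancel₀ hne, one_smul]
  rw [this]
  exact Subalgebra.smul_mem _ (aeval_mem_adjoin_singleton ℂ A) _

theorem reverse (h : IsEigenSystem n A E s) :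
    IsEigenSystem n A (fun i => E (n - i)) (fun i => s (n - i)) where
  mul_eq i hi j hj := by
    rw [h.mul_eq _ (Nat.sub_le _ _) _ (Nat.sub_le _ _)]
    by_cases hij : i = j
    · simp [hij]
    · rw [if_neg hij, if_neg (by omega)]
  sum_eq := by
    simpa using (Finset.sum_range_reflect E (n + 1)).trans h.sum_eq
  eig i hi := h.eig _ (Nat.sub_le _ _)
  inj i hi j hj hij := by
    have := h.inj _ (Nat.sub_le _ _) _ (Nat.sub_le _ _) hij
    omega

/-- Discarding idempotents that vanish does not change their sum. This trims the indices `0, …, D`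
to those that are seen by a given module. -/
theorem shift (h : IsEigenSystem n A E s) {t d : ℕ} (htd : t + d ≤ n)
    (hE : ∀ i ≤ n, E i ≠ 0 → t ≤ i ∧ i ≤ t + d) :
    IsEigenSystem d A (fun i => E (t + i)) (fun i => s (t + i)) where
  mul_eq i hi j hj := by
    rw [h.mul_eq _ (by omega) _ (by omega)]
    simp
  sum_eq := by
    rw [← h.sum_eq,
      ← Finset.sum_subset (s₁ := Finset.Ico t (t + (d + 1))) (s₂ := Finset.range (n + 1)) (f := E)]
    · rw [Finset.sum_Ico_eq_sum_range]
      simp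
    · intro i hi
      simp only [Finset.mem_Ico, Finset.mem_range] at *
      omega
    · intro i hi hi'
      simp only [Finset.mem_Ico, Finset.mem_range] at *
      by_contra h0
      have := hE i (by omega) h0
      omega
  eig i hi := h.eig _ (by omega)
  inj i hi j hj hij := by
    have := h.inj _ (by omega) _ (by omega) hij
    omega

end IsEigenSystem

end Eigen

/-! ### Tridiagonal systems -/

variable {W : Type*} [AddCommGroup W] [Module ℂ W]

/-- `f` has rank at most one. -/
def RankLEOne (f : End ℂ W) : Prop := ∀ w w', f w ≠ 0 → ∃ c : ℂ, f w' = c • f w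

theorem RankLEOne.trace_eq_one [FiniteDimensional ℂ W] {e : End ℂ W} (he : e * e = e)
    (h : RankLEOne e) (h0 : e ≠ 0) : LinearMap.trace ℂ W e = 1 := by
  obtain ⟨w, hw⟩ : ∃ w, e w ≠ 0 := by
    by_contra! hc
    exact h0 (LinearMap.ext hc)
  have hp : LinearMap.IsProj (LinearMap.range e) e :=
    ⟨fun x => ⟨x, rfl⟩, by
      rintro _ ⟨y, rfl⟩
      rw [← Module.End.mul_apply, he]⟩
  rw [hp.trace]
  have : finrank ℂ (LinearMap.range e) = 1 := by
    rw [finrank_eq_one_iff']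
    refine ⟨⟨e w, w, rfl⟩, fun h => hw (congrArg Subtype.val h), ?_⟩
    rintro ⟨_, y, rfl⟩
    obtain ⟨c, hc⟩ := h w y hw
    exact ⟨c, Subtype.ext hc.symm⟩
  simp [this]

/-- The map `e g e` acts on a line, hence is a multiple of `e`; the factor is found from `tr(e g e)
= tr(e g)`. In this way `a_i` and `a*_i`, defined as traces, become the diagonal coefficients of the
tridiagonal actions. -/
theorem RankLEOne.mul_mul_eq [FiniteDimensional ℂ W] {e : End ℂ W} (he : e * e = e)
    (h : RankLEOne e) (g : End ℂ W) : e * g * e = LinearMap.trace ℂ W (e * g) • e := by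
  by_cases h0 : e = 0
  · simp [h0]
  obtain ⟨w, hw⟩ : ∃ w, e w ≠ 0 := by
    by_contra! hc
    exact h0 (LinearMap.ext hc)
  obtain ⟨c, hc⟩ := h w (g (e w)) hw
  have key : e * g * e = c • e := by
    ext y
    obtain ⟨b, hb⟩ := h w y hw
    simp only [Module.End.mul_apply, LinearMap.smul_apply, hb, map_smul, hc]
    rw [smul_comm]
  have : LinearMap.trace ℂ W (e * g) = c := by
    have h1 : LinearMap.trace ℂ W (e * g * e) = LinearMap.trace ℂ W (e * g) := by
      rw [LinearMap.trace_mul_comm, ← mul_assoc, he]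
    rw [← h1, key, map_smul, h.trace_eq_one he h0, smul_eq_mul, mul_one]
  rw [key, this]

theorem IsEigenSystem.sum_apply {n : ℕ} {A : End ℂ W} {E : ℕ → End ℂ W} {s : ℕ → ℂ}
    (h : IsEigenSystem n A E s) (w : W) : ∑ i ∈ Finset.range (n + 1), E i w = w := by
  have := congrArg (fun f : End ℂ W => f w) h.sum_eq
  simpa using this

/-- For rank one idempotents, the number of nonzero ones is the dimension. -/
theorem IsEigenSystem.finrank_eq [FiniteDimensional ℂ W] {n : ℕ} {A : End ℂ W}
    {E : ℕ → End ℂ W} {s : ℕ → ℂ}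
    (h : IsEigenSystem n A E s) (hE : ∀ i ≤ n, RankLEOne (E i)) :
    {i | i ≤ n ∧ E i ≠ 0}.ncard = finrank ℂ W := by
  classical
  have h1 : LinearMap.trace ℂ W (1 : End ℂ W) = finrank ℂ W := LinearMap.trace_one ℂ W
  rw [← h.sum_eq, map_sum] at h1
  have h2 : ∀ i ∈ Finset.range (n + 1),
      LinearMap.trace ℂ W (E i) = if E i ≠ 0 then 1 else 0 := by
    intro i hi
    have hi : i ≤ n := by grind
    split_ifs with h0
    · exact (hE i hi).trace_eq_one (by simpa using h.mul_eq i hi i hi) h0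
    · rw [not_not.mp h0, map_zero]
  rw [Finset.sum_congr rfl h2, Finset.sum_boole, Nat.cast_inj] at h1
  rw [← h1, ← Set.ncard_coe_finset]
  congr 1
  ext i
  simp

/-- `A` acts on the eigenspaces of `As` in a tridiagonal fashion and vice versa, and no proper
nonzero subspace is invariant under both `A` and `As`. -/
structure IsTridiagonalSystem (m n : ℕ) (A As : End ℂ W) (E F : ℕ → End ℂ W) (s ss : ℕ → ℂ) :
    Prop where
  eigen : IsEigenSystem m A E s
  eigen_dual : IsEigenSystem n As F ss
  tri : ∀ i ≤ n, ∀ j ≤ n, i + 1 < j ∨ j + 1 < i → F i * A * F j = 0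
  tri_dual : ∀ i ≤ m, ∀ j ≤ m, i + 1 < j ∨ j + 1 < i → E i * As * E j = 0
  irreducible : ∀ U : Submodule ℂ W, (∀ w ∈ U, A w ∈ U) → (∀ w ∈ U, As w ∈ U) → U = ⊥ ∨ U = ⊤

namespace IsTridiagonalSystem

variable {m n : ℕ} {A As : End ℂ W} {E F : ℕ → End ℂ W} {s ss : ℕ → ℂ}

theorem dual (h : IsTridiagonalSystem m n A As E F s ss) :
    IsTridiagonalSystem n m As A F E ss s :=
  ⟨h.eigen_dual, h.eigen, h.tri_dual, h.tri, fun U h1 h2 => h.irreducible U h2 h1⟩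

theorem shift (h : IsTridiagonalSystem m n A As E F s ss) {t d : ℕ} (htd : t + d ≤ m)
    (hE : ∀ i ≤ m, E i ≠ 0 → t ≤ i ∧ i ≤ t + d) :
    IsTridiagonalSystem d n A As (fun i => E (t + i)) F (fun i => s (t + i)) ss :=
  ⟨h.eigen.shift htd hE, h.eigen_dual, h.tri,
    fun i _ j _ hij => h.tri_dual _ (by omega) _ (by omega) (by omega), h.irreducible⟩

theorem reverse (h : IsTridiagonalSystem m n A As E F s ss) :
    IsTridiagonalSystem m n A As (fun i => E (m - i)) F (fun i => s (m - i)) ss :=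
  ⟨h.eigen.reverse, h.eigen_dual, h.tri,
    fun i _ j _ hij => h.tri_dual _ (by omega) _ (by omega) (by omega), h.irreducible⟩

theorem apply_map_eq_sum (h : IsTridiagonalSystem m n A As E F s ss) (i : ℕ) (w : W) :
    F i (A w) = ∑ l ∈ Finset.range (n + 1), F i (A (F l w)) := by
  conv_lhs => rw [← h.eigen_dual.sum_apply w]
  simp

theorem tri_apply (h : IsTridiagonalSystem m n A As E F s ss) {i j : ℕ} (hi : i ≤ n) (hj : j ≤ n)
    (hij : i + 1 < j ∨ j + 1 < i) (w : W) : F i (A (F j w)) = 0 := by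
  have := congrArg (fun f : End ℂ W => f w) (h.tri i hi j hj hij)
  simpa using this

theorem mul_apply_eq (h : IsEigenSystem n As F ss) {i j : ℕ} (hi : i ≤ n) (hj : j ≤ n) (w : W) :
    F i (F j w) = if i = j then F i w else 0 := by
  have := congrArg (fun f : End ℂ W => f w) (h.mul_eq i hi j hj)
  simp only [Module.End.mul_apply] at this
  rw [this]
  split_ifs <;> rfl

theorem eig_apply (h : IsEigenSystem n As F ss) {i : ℕ} (hi : i ≤ n) (w : W) :
    F i (As w) = ss i • F i w := by
  have := congrArg (fun f : End ℂ W => f w) (h.mul_eig hi)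
  simpa using this

/-- If this raising map vanished, the sum of the `F_l W` with `l ≤ j` would be stable under `A` and
`As`. It contains `F_i W` but not `F_k W`, which contradicts irreducibility. -/
theorem raise_ne_zero (h : IsTridiagonalSystem m n A As E F s ss) {i j k : ℕ} (hij : i ≤ j)
    (hjk : j < k) (hk : k ≤ n) (hFi : F i ≠ 0) (hFk : F k ≠ 0) : F (j + 1) * A * F j ≠ 0 := by
  intro h0
  -- Vectors with no component above level `j`.
  let U : Submodule ℂ W :=
    { carrier := {w | ∀ l, j < l → l ≤ n → F l w = 0}
      add_mem' := fun ha hb l h1 h2 => by rw [map_add, ha l h1 h2, hb l h1 h2, add_zero]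
      zero_mem' := fun l _ _ => map_zero _
      smul_mem' := fun c w hw l h1 h2 => by rw [map_smul, hw l h1 h2, smul_zero] }
  have hA : ∀ w ∈ U, A w ∈ U := by
    intro w hw l h1 h2
    rw [h.apply_map_eq_sum]
    refine Finset.sum_eq_zero fun l' hl' => ?_
    have hl' : l' ≤ n := by grind
    by_cases hl : j < l'
    · rw [hw l' hl hl', map_zero, map_zero]
    by_cases hl2 : l' + 1 < l
    · exact h.tri_apply h2 hl' (Or.inr hl2) w
    obtain rfl : l' = j := by omega
    obtain rfl : l = l' + 1 := by omega
    have := congrArg (fun f : End ℂ W => f w) h0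
    simpa using this
  have hAs : ∀ w ∈ U, As w ∈ U := by
    intro w hw l h1 h2
    rw [eig_apply h.eigen_dual h2, hw l h1 h2, smul_zero]
  rcases h.irreducible U hA hAs with hU | hU
  · refine hFi (LinearMap.ext fun w => ?_)
    have : F i w ∈ U := by
      intro l h1 h2
      rw [mul_apply_eq h.eigen_dual h2 (by omega), if_neg (by omega)]
    rw [hU] at this
    simpa using this
  · refine hFk (LinearMap.ext fun w => ?_)
    have : w ∈ U := hU ▸ Submodule.mem_top
    exact this k hjk hk

theorem ne_zero_of_between (h : IsTridiagonalSystem m n A As E F s ss) {i j k : ℕ} (hij : i ≤ j)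
    (hjk : j ≤ k) (hk : k ≤ n) (hFi : F i ≠ 0) (hFk : F k ≠ 0) : F j ≠ 0 := by
  rcases hjk.eq_or_lt with rfl | hjk
  · exact hFk
  intro h0
  exact h.raise_ne_zero hij hjk hk hFi hFk (by rw [h0, mul_zero])

/-- The indices of the nonzero `F_i` form an interval. -/
theorem support_eq (h : IsTridiagonalSystem m n A As E F s ss) {r d : ℕ}
    (hr : sInf {i | i ≤ n ∧ F i ≠ 0} = r) (hd : {i | i ≤ n ∧ F i ≠ 0}.ncard = d + 1) :
    r + d ≤ n ∧ (∀ i ≤ n, F i ≠ 0 ↔ r ≤ i ∧ i ≤ r + d) := by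
  set S := {i | i ≤ n ∧ F i ≠ 0} with hS
  have hfin : S.Finite := (Set.finite_Iic n).subset fun i hi => hi.1
  have hne : S.Nonempty := Set.nonempty_of_ncard_ne_zero (by omega)
  have hrS : r ∈ S := hr ▸ Nat.sInf_mem hne
  obtain ⟨M, hM, hmax⟩ := hfin.exists_maximal hne
  have hle : ∀ i ∈ S, i ≤ M := fun i hi => by
    by_contra hc
    exact hc (hmax hi (by omega))
  have hrM : r ≤ M := hle r hrS
  have hSI : S = Finset.Icc r M := by
    ext i
    simp only [Finset.coe_Icc, Set.mem_Icc]
    refine ⟨fun hi => ⟨hr ▸ Nat.sInf_le hi, hle i hi⟩, fun hi => ⟨hi.2.trans hM.1, ?_⟩⟩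
    exact h.ne_zero_of_between hi.1 hi.2 hM.1 hrS.2 hM.2
  rw [hSI, Set.ncard_coe_finset, Nat.card_Icc] at hd
  have hMd : M = r + d := by omega
  refine ⟨hMd ▸ hM.1, fun i hi => ?_⟩
  have := Set.ext_iff.mp hSI i
  simp only [hS, Set.mem_ofPred_eq, Finset.coe_Icc, Set.mem_Icc] at this
  rw [← hMd, ← this]
  simp [hi]

end IsTridiagonalSystem

end DRG

end

/-! ### Split vectors and Leonard systems -/

noncomputable section

namespace DRG

open Polynomial Module

/-- `∏_{h < i} (X - s_h)`. -/
def splitPoly (s : ℕ → ℂ) (i : ℕ) : ℂ[X] := ∏ h ∈ Finset.range i, (X - C (s h))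

theorem eval_splitPoly (s : ℕ → ℂ) (i : ℕ) (a : ℂ) :
    (splitPoly s i).eval a = ∏ h ∈ Finset.range i, (a - s h) := by
  simp [splitPoly, eval_prod]

theorem eval_splitPoly_eq_zero (s : ℕ → ℂ) {h i : ℕ} (hi : h < i) :
    (splitPoly s i).eval (s h) = 0 := by
  rw [eval_splitPoly]
  exact Finset.prod_eq_zero (Finset.mem_range.mpr hi) (sub_self _)

theorem degree_splitPoly (s : ℕ → ℂ) (i : ℕ) : (splitPoly s i).degree = i := by
  simp [splitPoly, degree_prod]

variable {W : Type*} [AddCommGroup W] [Module ℂ W]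

/-- `∏_{h < i} (A - s_h) u`. -/
def splitVec (A : End ℂ W) (s : ℕ → ℂ) (u : W) (i : ℕ) : W := aeval A (splitPoly s i) u

theorem splitVec_zero (A : End ℂ W) (s : ℕ → ℂ) (u : W) : splitVec A s u 0 = u := by
  simp [splitVec, splitPoly]

theorem map_splitVec (A : End ℂ W) (s : ℕ → ℂ) (u : W) (i : ℕ) :
    A (splitVec A s u i) = s i • splitVec A s u i + splitVec A s u (i + 1) := by
  simp only [splitVec, splitPoly, Finset.prod_range_succ]
  rw [mul_comm]
  simp [Algebra.algebraMap_eq_smul_one]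

namespace IsTridiagonalSystem

variable {m n : ℕ} {A As : End ℂ W} {E F : ℕ → End ℂ W} {s ss : ℕ → ℂ} {u : W}

/-- Each factor `A - s_h` raises the level by at most one, and `u` has level `0`. -/
theorem apply_splitVec_eq_zero (h : IsTridiagonalSystem m n A As E F s ss) (hu : F 0 u = u)
    {i j : ℕ} (hij : i < j) (hj : j ≤ n) : F j (splitVec A s u i) = 0 := by
  induction i generalizing j with
  | zero =>
    rw [splitVec_zero, ← hu, mul_apply_eq h.eigen_dual hj (by omega), if_neg (by omega)]
  | succ i ih =>
    have := congrArg (F j) (map_splitVec A s u i)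
    rw [map_add, map_smul, ih (by omega) hj, smul_zero, zero_add] at this
    rw [← this, h.apply_map_eq_sum]
    refine Finset.sum_eq_zero fun l hl => ?_
    have hl : l ≤ n := by grind
    by_cases hil : i < l
    · rw [ih hil hl, map_zero, map_zero]
    · exact h.tri_apply hj hl (by omega) _

theorem apply_splitVec_succ (h : IsTridiagonalSystem m n A As E F s ss) (hu : F 0 u = u)
    {i : ℕ} (hi : i < n) :
    F (i + 1) (splitVec A s u (i + 1)) = F (i + 1) (A (F i (splitVec A s u i))) := by
  have := congrArg (F (i + 1)) (map_splitVec A s u i)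
  rw [map_add, map_smul, h.apply_splitVec_eq_zero hu (by omega) (by omega), smul_zero,
    zero_add] at this
  rw [← this, h.apply_map_eq_sum]
  refine Finset.sum_eq_single_of_mem i (by grind) fun l hl hli => ?_
  have hl : l ≤ n := by grind
  by_cases hil : i < l
  · rw [h.apply_splitVec_eq_zero hu hil hl, map_zero, map_zero]
  · exact h.tri_apply (by omega) hl (by omega) _

/-- The top component of the next split vector is the raising map applied to the top component of
the present one. On a line, a nonzero linear map has no kernel. -/
theorem apply_splitVec_ne_zero (h : IsTridiagonalSystem m n A As E F s ss) (hu : F 0 u = u)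
    (hu0 : u ≠ 0) (hF : ∀ i ≤ n, F i ≠ 0) (hF1 : ∀ i ≤ n, RankLEOne (F i)) {i : ℕ} (hi : i ≤ n) :
    F i (splitVec A s u i) ≠ 0 := by
  induction i with
  | zero => rwa [splitVec_zero, hu]
  | succ i ih =>
    have ih := ih (by omega)
    rw [h.apply_splitVec_succ hu (by omega)]
    intro h0
    refine h.raise_ne_zero le_rfl (Nat.lt_succ_self i) hi (hF i (by omega)) (hF _ hi) ?_
    ext w
    obtain ⟨c, hc⟩ := hF1 i (by omega) _ w ih
    simp [hc, h0]

theorem splitVec_ne_zero (h : IsTridiagonalSystem m n A As E F s ss) (hu : F 0 u = u)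
    (hu0 : u ≠ 0) (hF : ∀ i ≤ n, F i ≠ 0) (hF1 : ∀ i ≤ n, RankLEOne (F i)) {i : ℕ} (hi : i ≤ n) :
    splitVec A s u i ≠ 0 := fun h0 =>
  h.apply_splitVec_ne_zero hu hu0 hF hF1 hi (by rw [h0, map_zero])

/-- Triangular elimination: the `F_k`-component of `w` is a multiple of that of the `k`-th split
vector, so subtracting this multiple lowers the level. -/
theorem mem_span_splitVec (h : IsTridiagonalSystem m n A As E F s ss) (hu : F 0 u = u)
    (hu0 : u ≠ 0) (hF : ∀ i ≤ n, F i ≠ 0) (hF1 : ∀ i ≤ n, RankLEOne (F i)) {k : ℕ}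
    (hk : k ≤ n + 1) {w : W} (hw : ∀ j, k ≤ j → j ≤ n → F j w = 0) :
    w ∈ Submodule.span ℂ (splitVec A s u '' Set.Iio k) := by
  induction k generalizing w with
  | zero =>
    have : w = 0 := by
      rw [← h.eigen_dual.sum_apply w]
      exact Finset.sum_eq_zero fun i hi => hw i (by omega) (by grind)
    rw [this]
    exact Submodule.zero_mem _
  | succ k ih =>
    obtain ⟨c, hc⟩ := hF1 k (by omega) _ w (h.apply_splitVec_ne_zero hu hu0 hF hF1 (by omega))
    have h1 : w - c • splitVec A s u k ∈ Submodule.span ℂ (splitVec A s u '' Set.Iio k) := by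
      refine ih (by omega) fun j hkj hj => ?_
      rw [map_sub, map_smul]
      rcases hkj.eq_or_lt with rfl | hlt
      · rw [hc, sub_self]
      · rw [hw j hlt hj, h.apply_splitVec_eq_zero hu hlt hj, smul_zero, sub_zero]
    have h2 : w = (w - c • splitVec A s u k) + c • splitVec A s u k := by simp
    rw [h2]
    refine Submodule.add_mem _ (Submodule.span_mono ?_ h1)
      (Submodule.smul_mem _ _ (Submodule.subset_span ⟨k, by simp, rfl⟩))
    exact Set.image_mono (Set.Iio_subset_Iio (Nat.le_succ k))

theorem span_splitVec (h : IsTridiagonalSystem m n A As E F s ss) (hu : F 0 u = u)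
    (hu0 : u ≠ 0) (hF : ∀ i ≤ n, F i ≠ 0) (hF1 : ∀ i ≤ n, RankLEOne (F i)) (w : W) :
    w ∈ Submodule.span ℂ (splitVec A s u '' Set.Iio (n + 1)) :=
  h.mem_span_splitVec hu hu0 hF hF1 le_rfl fun j h1 h2 => by omega

theorem exists_aeval_of_mem_span {k : ℕ} {w : W}
    (hw : w ∈ Submodule.span ℂ (splitVec A s u '' Set.Iio k)) :
    ∃ p : ℂ[X], p.degree < k ∧ aeval A p u = w := by
  induction hw using Submodule.span_induction with
  | mem w hw =>
    obtain ⟨i, hi, rfl⟩ := hw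
    exact ⟨splitPoly s i, by rw [degree_splitPoly]; exact_mod_cast hi, rfl⟩
  | zero => exact ⟨0, by simp, by simp⟩
  | add w w' _ _ h1 h2 =>
    obtain ⟨p, hp, rfl⟩ := h1
    obtain ⟨q, hq, rfl⟩ := h2
    exact ⟨p + q, (degree_add_le _ _).trans_lt (max_lt hp hq), by simp⟩
  | smul c w _ h1 =>
    obtain ⟨p, hp, rfl⟩ := h1
    exact ⟨c • p, (degree_smul_le _ _).trans_lt hp, by simp⟩

theorem exists_aeval (h : IsTridiagonalSystem m n A As E F s ss) (hu : F 0 u = u)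
    (hu0 : u ≠ 0) (hF : ∀ i ≤ n, F i ≠ 0) (hF1 : ∀ i ≤ n, RankLEOne (F i)) (w : W) :
    ∃ p : ℂ[X], aeval A p u = w :=
  let ⟨p, _, hp⟩ := exists_aeval_of_mem_span (h.span_splitVec hu hu0 hF hF1 w)
  ⟨p, hp⟩

theorem apply_aeval (h : IsEigenSystem m A E s) {i : ℕ} (hi : i ≤ m) (p : ℂ[X]) (w : W) :
    E i (aeval A p w) = p.eval (s i) • E i w := by
  have := congrArg (fun f : End ℂ W => f w) (h.mul_aeval hi p)
  simpa using this

/-- Because `u` is cyclic and `E_i p(A) u = p(s_i) E_i u`, the range of `E_i` is spanned by `E_i u`.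
Thus thinness passes from the `F_i` to the `E_i`. -/
theorem rankLEOne (h : IsTridiagonalSystem m n A As E F s ss) (hu : F 0 u = u)
    (hu0 : u ≠ 0) (hF : ∀ i ≤ n, F i ≠ 0) (hF1 : ∀ i ≤ n, RankLEOne (F i)) {i : ℕ} (hi : i ≤ m) :
    RankLEOne (E i) := by
  intro w w' hw
  obtain ⟨p, rfl⟩ := h.exists_aeval hu hu0 hF hF1 w
  obtain ⟨q, rfl⟩ := h.exists_aeval hu hu0 hF hF1 w'
  rw [apply_aeval h.eigen hi] at hw ⊢
  have : p.eval (s i) ≠ 0 := left_ne_zero_of_smul hw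
  refine ⟨q.eval (s i) * (p.eval (s i))⁻¹, ?_⟩
  rw [apply_aeval h.eigen hi, smul_smul, inv_mul_cancel_right₀ this]

theorem apply_ne_zero (h : IsTridiagonalSystem m n A As E F s ss) (hu : F 0 u = u)
    (hu0 : u ≠ 0) (hF : ∀ i ≤ n, F i ≠ 0) (hF1 : ∀ i ≤ n, RankLEOne (F i)) {i : ℕ} (hi : i ≤ m)
    (hE : E i ≠ 0) : E i u ≠ 0 := by
  intro h0
  refine hE (LinearMap.ext fun w => ?_)
  obtain ⟨p, rfl⟩ := h.exists_aeval hu hu0 hF hF1 w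
  rw [apply_aeval h.eigen hi, h0, smul_zero, LinearMap.zero_apply]

end IsTridiagonalSystem

/-- A Leonard system of diameter `d`, with a nonzero vector `u` in the range of `F_0`. -/
structure IsLeonardSystem (d : ℕ) (A As : End ℂ W) (E F : ℕ → End ℂ W) (s ss : ℕ → ℂ) (u : W) :
    Prop extends IsTridiagonalSystem d d A As E F s ss where
  ne_zero : ∀ i ≤ d, E i ≠ 0
  ne_zero_dual : ∀ i ≤ d, F i ≠ 0
  rank_dual : ∀ i ≤ d, RankLEOne (F i)
  vec_mem : F 0 u = u
  vec_ne : u ≠ 0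

/-! ### Bidiagonal action on the split basis -/

namespace IsLeonardSystem

open IsTridiagonalSystem

variable {d : ℕ} {A As : End ℂ W} {E F : ℕ → End ℂ W} {s ss : ℕ → ℂ} {u : W}

/-- Inverting the order of the `E_i` exchanges the first and second split sequences, and makes every
statement about `E_d` a statement about `E_0`. -/
theorem reverse (h : IsLeonardSystem d A As E F s ss u) :
    IsLeonardSystem d A As (fun i => E (d - i)) F (fun i => s (d - i)) ss u :=
  ⟨h.toIsTridiagonalSystem.reverse, fun i _ => h.ne_zero _ (Nat.sub_le d i), h.ne_zero_dual,
    h.rank_dual, h.vec_mem, h.vec_ne⟩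

theorem apply_vec_ne_zero (h : IsLeonardSystem d A As E F s ss u) {i : ℕ} (hi : i ≤ d) :
    E i u ≠ 0 :=
  h.apply_ne_zero h.vec_mem h.vec_ne h.ne_zero_dual h.rank_dual hi (h.ne_zero i hi)

theorem rank (h : IsLeonardSystem d A As E F s ss u) {i : ℕ} (hi : i ≤ d) : RankLEOne (E i) :=
  h.rankLEOne h.vec_mem h.vec_ne h.ne_zero_dual h.rank_dual hi

theorem map_vec_dual (h : IsLeonardSystem d A As E F s ss u) : As u = ss 0 • u := by
  have := congrArg (fun f : End ℂ W => f u) (h.eigen_dual.eig 0 (Nat.zero_le _))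
  simpa [h.vec_mem] using this

/-- Here `p(A) u = ∑ p(s_i) E_i u`, with no `E_i u` equal to zero. So the annihilator of `u` depends
only on the eigenvalues. -/
theorem aeval_eq_zero_iff (h : IsLeonardSystem d A As E F s ss u) (p : ℂ[X]) :
    aeval A p u = 0 ↔ ∀ i ≤ d, p.eval (s i) = 0 := by
  constructor
  · intro h0 i hi
    have := apply_aeval h.eigen hi p u
    rw [h0, map_zero, eq_comm, smul_eq_zero] at this
    exact this.resolve_right (h.apply_vec_ne_zero hi)
  · intro h0
    rw [← h.eigen.sum_apply (aeval A p u)]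
    refine Finset.sum_eq_zero fun i hi => ?_
    rw [apply_aeval h.eigen (by grind), h0 i (by grind), zero_smul]

theorem apply_splitVec_eq_zero_of_lt (h : IsLeonardSystem d A As E F s ss u) {i j : ℕ}
    (hij : j < i) (hj : j ≤ d) : E j (splitVec A s u i) = 0 := by
  rw [splitVec, apply_aeval h.eigen hj, eval_splitPoly_eq_zero s hij, zero_smul]

/-- Such a `w` is `p(A) u` with `deg p < k`, and `p` has the `k` distinct roots `s_0, …, s_{k-1}`.
-/
theorem eq_zero_of_mem_span (h : IsLeonardSystem d A As E F s ss u) {k : ℕ} (hk : k ≤ d + 1)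
    {w : W} (hw : w ∈ Submodule.span ℂ (splitVec A s u '' Set.Iio k))
    (h0 : ∀ j < k, E j w = 0) : w = 0 := by
  obtain ⟨p, hp, rfl⟩ := exists_aeval_of_mem_span hw
  have hp0 : p = 0 := by
    refine eq_zero_of_degree_lt_of_eval_index_eq_zero (v := s) (Finset.range k) ?_ (by simpa) ?_
    · intro i hi j hj hij
      simp only [Finset.coe_range, Set.mem_Iio] at hi hj
      exact h.eigen.inj i (by omega) j (by omega) hij
    · intro i hi
      have hi : i < k := by simpa using hi
      have := apply_aeval h.eigen (show i ≤ d by omega) p u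
      rw [h0 i hi, eq_comm, smul_eq_zero] at this
      exact this.resolve_right (h.apply_vec_ne_zero (by omega))
  simp [hp0]

/-- `As` acts on the split basis in an upper bidiagonal fashion. -/
theorem exists_split (h : IsLeonardSystem d A As E F s ss u) {i : ℕ} (hi : i < d) :
    ∃ c : ℂ, As (splitVec A s u (i + 1)) =
      ss (i + 1) • splitVec A s u (i + 1) + c • splitVec A s u i := by
  set v := splitVec A s u with hv
  set w := As (v (i + 1)) - ss (i + 1) • v (i + 1) with hw
  -- Subtracting `ss (i + 1)` cancels the top component, so `w` lies in the span of `v 0, …, v i`.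
  have hwF : ∀ j, i + 1 ≤ j → j ≤ d → F j w = 0 := by
    intro j hij hj
    rw [hw, map_sub, map_smul, eig_apply h.eigen_dual hj]
    rcases hij.eq_or_lt with rfl | hlt
    · rw [sub_self]
    · rw [h.toIsTridiagonalSystem.apply_splitVec_eq_zero h.vec_mem hlt hj, smul_zero, smul_zero,
        sub_zero]
  -- `v (i + 1)` has no `E_l`-component for `l ≤ i`, and `As` reaches down by at most one index.
  -- This removes `v 0, …, v (i - 1)` from the expansion of `w`.
  have hwE : ∀ j < i, E j w = 0 := by
    intro j hj
    rw [hw, map_sub, map_smul, h.apply_splitVec_eq_zero_of_lt (by omega) (by omega), smul_zero,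
      sub_zero, h.dual.apply_map_eq_sum]
    refine Finset.sum_eq_zero fun l hl => ?_
    have hl : l ≤ d := by grind
    by_cases hli : l < i + 1
    · rw [h.apply_splitVec_eq_zero_of_lt hli hl, map_zero, map_zero]
    · exact h.dual.tri_apply (by omega) hl (by omega) _
  have hmem := h.mem_span_splitVec h.vec_mem h.vec_ne h.ne_zero_dual h.rank_dual
    (show i + 1 ≤ d + 1 by omega) hwF
  have hIio : Set.Iio (i + 1) = insert i (Set.Iio i) := by
    ext j
    simp only [Set.mem_Iio, Set.mem_insert_iff]
    omega
  rw [hIio, Set.image_insert_eq, Submodule.mem_span_insert] at hmem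
  obtain ⟨c, z, hz, hwz⟩ := hmem
  have hz0 : z = 0 := by
    refine h.eq_zero_of_mem_span (k := i) (by omega) hz fun j hj => ?_
    have := congrArg (E j) hwz
    rw [hwE j hj, map_add, map_smul, h.apply_splitVec_eq_zero_of_lt hj (by omega), smul_zero,
      zero_add] at this
    exact this.symm
  refine ⟨c, ?_⟩
  rw [hz0, add_zero] at hwz
  rw [← hwz, hw]
  abel

/-- The scalars describing the action of `As` on the split basis. -/
def split (A As : End ℂ W) (s ss : ℕ → ℂ) (u : W) (i : ℕ) : ℂ :=
  Classical.epsilon fun c : ℂ => As (splitVec A s u i) =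
      ss i • splitVec A s u i + c • splitVec A s u (i - 1)

theorem map_splitVec_dual (h : IsLeonardSystem d A As E F s ss u) {i : ℕ} (hi : i < d) :
    As (splitVec A s u (i + 1)) = ss (i + 1) • splitVec A s u (i + 1) +
      split A As s ss u (i + 1) • splitVec A s u i :=
  Classical.epsilon_spec (p := fun c : ℂ => As (splitVec A s u (i + 1)) =
      ss (i + 1) • splitVec A s u (i + 1) + c • splitVec A s u (i + 1 - 1)) (h.exists_split hi)

theorem last_apply_map (h : IsTridiagonalSystem d d A As E F s ss) (hd : 0 < d) (w : W) :
    F d (A w) = F d (A (F d w)) + F d (A (F (d - 1) w)) := by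
  rw [h.apply_map_eq_sum, ← Finset.sum_subset (s₁ := {d, d - 1})]
  · rw [Finset.sum_pair (by omega)]
  · intro i hi
    simp only [Finset.mem_insert, Finset.mem_singleton, Finset.mem_range] at *
    omega
  · intro i hi hi'
    simp only [Finset.mem_insert, Finset.mem_singleton, Finset.mem_range] at *
    exact h.tri_apply le_rfl (by omega) (by omega) _

theorem eval_splitPoly_ne_zero (h : IsLeonardSystem d A As E F s ss u) {i : ℕ} (hi : i ≤ d) :
    (splitPoly s i).eval (s d) ≠ 0 := by
  rw [eval_splitPoly, Finset.prod_ne_zero_iff]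
  intro j hj h0
  have := h.eigen.inj d le_rfl j (by grind) (sub_eq_zero.mp h0)
  grind

/-! ### The ends of the split sequence in terms of traces -/

section Scalars

variable [FiniteDimensional ℂ W]

theorem apply_map_apply (h : IsLeonardSystem d A As E F s ss u) {i : ℕ} (hi : i ≤ d) (w : W) :
    E i (As (E i w)) = LinearMap.trace ℂ W (E i * As) • E i w := by
  have := congrArg (fun f : End ℂ W => f w)
    ((h.rank hi).mul_mul_eq (by simpa using h.eigen.mul_eq i hi i hi) As)
  simpa using this

theorem apply_map_apply_dual (h : IsLeonardSystem d A As E F s ss u) {i : ℕ} (hi : i ≤ d)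
    (w : W) : F i (A (F i w)) = LinearMap.trace ℂ W (F i * A) • F i w := by
  have := congrArg (fun f : End ℂ W => f w)
    ((h.rank_dual i hi).mul_mul_eq (by simpa using h.eigen_dual.mul_eq i hi i hi) A)
  simpa using this

/-- `E_d As p(A) u` depends on `p(s_d)` and `p(s_{d-1})` only. -/
theorem last_apply_aeval (h : IsLeonardSystem d A As E F s ss u) (hd : 0 < d) (p : ℂ[X]) :
    E d (As (aeval A p u)) = (LinearMap.trace ℂ W (E d * As) * p.eval (s d) +
      (ss 0 - LinearMap.trace ℂ W (E d * As)) * p.eval (s (d - 1))) • E d u := by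
  have h1 := last_apply_map h.dual hd u
  rw [h.map_vec_dual, map_smul, h.apply_map_apply le_rfl] at h1
  -- The eigenvector equation `As u = ss 0 • u` determines the off-diagonal coefficient from the
  -- diagonal one.
  have h2 : E d (As (E (d - 1) u)) = (ss 0 - LinearMap.trace ℂ W (E d * As)) • E d u := by
    rw [sub_smul, h1, add_sub_cancel_left]
  rw [last_apply_map h.dual hd, apply_aeval h.eigen le_rfl, apply_aeval h.eigen (Nat.sub_le _ _),
    map_smul, map_smul, map_smul, map_smul, h.apply_map_apply le_rfl, h2, add_smul, mul_smul,
    mul_smul, smul_comm, smul_comm (p.eval (s (d - 1)))]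

/-- Compare the `E_d`-components of both sides of the bidiagonal formula for `As`. The factor
`τ_i(s_d)` is nonzero, so the whole split sequence is determined by the trace of `E_d As` and the
two eigenvalue sequences. -/
theorem split_mul (h : IsLeonardSystem d A As E F s ss u) {i : ℕ} (hi : i < d) :
    split A As s ss u (i + 1) * (splitPoly s i).eval (s d) =
      (LinearMap.trace ℂ W (E d * As) - ss (i + 1)) * (splitPoly s (i + 1)).eval (s d) +
      (ss 0 - LinearMap.trace ℂ W (E d * As)) * (splitPoly s (i + 1)).eval (s (d - 1)) := by
  have h1 := h.last_apply_aeval (by omega) (splitPoly s (i + 1))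
  change E d (As (splitVec A s u (i + 1))) = _ at h1
  rw [h.map_splitVec_dual hi, map_add, map_smul, map_smul, splitVec, splitVec,
    apply_aeval h.eigen le_rfl, apply_aeval h.eigen le_rfl, smul_smul, smul_smul, ← add_smul] at h1
  have := smul_left_injective ℂ (h.apply_vec_ne_zero le_rfl) h1
  linear_combination this

theorem split_last (h : IsLeonardSystem d A As E F s ss u) (hd : 0 < d) :
    split A As s ss u d = (LinearMap.trace ℂ W (E d * As) - ss d) * (s d - s (d - 1)) := by
  obtain ⟨i, rfl⟩ : ∃ i, d = i + 1 := ⟨d - 1, by omega⟩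
  have h1 := h.split_mul (Nat.lt_succ_self i)
  rw [Nat.add_sub_cancel, eval_splitPoly_eq_zero s (Nat.lt_succ_self i), mul_zero, add_zero] at h1
  have h2 := h.eval_splitPoly_ne_zero (Nat.le_succ i)
  apply mul_right_cancel₀ h2
  rw [Nat.add_sub_cancel, h1, eval_splitPoly, eval_splitPoly, Finset.prod_range_succ]
  ring

theorem split_one (h : IsLeonardSystem d A As E F s ss u) (hd : 0 < d) :
    split A As s ss u 1 = (ss 0 - LinearMap.trace ℂ W (E 0 * As)) * (s 1 - s 0) := by
  -- The last idempotent of the reversed system is `E 0`; the polynomial stays that of the original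
  -- order, and it vanishes at `s 0`.
  have h1 := h.reverse.last_apply_aeval hd (splitPoly s 1)
  change E (d - d) (As (splitVec A s u 1)) = _ at h1
  simp only [Nat.sub_self, show d - (d - 1) = 1 by omega] at h1
  have h2 : splitVec A s u 1 = aeval A (splitPoly s 1) u := rfl
  rw [h.map_splitVec_dual hd, map_add, map_smul, map_smul,
    h.apply_splitVec_eq_zero_of_lt Nat.zero_lt_one (Nat.zero_le d), smul_zero, zero_add,
    splitVec_zero, eval_splitPoly_eq_zero s Nat.zero_lt_one, mul_zero, zero_add] at h1
  have := smul_left_injective ℂ (h.apply_vec_ne_zero (Nat.zero_le d)) h1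
  simpa [splitPoly] using this

/-- The `F_0`-component of the first split vector `(A - s_0) u` is `(a_0 - s_0) u`; comparing it in
the formula for `As` gives the relation. -/
theorem split_one_dual (h : IsLeonardSystem d A As E F s ss u) (hd : 0 < d) :
    split A As s ss u 1 = (LinearMap.trace ℂ W (F 0 * A) - s 0) * (ss 0 - ss 1) := by
  have h1 := congrArg (F 0) (h.map_splitVec_dual hd)
  have h2 := congrArg (F 0) (map_splitVec A s u 0)
  have h3 := h.apply_map_apply_dual (Nat.zero_le d) u
  simp only [zero_add] at h1 h2
  rw [eig_apply h.eigen_dual (Nat.zero_le d), map_add, map_smul, map_smul, splitVec_zero,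
    h.vec_mem] at h1
  rw [splitVec_zero, map_add, map_smul, h.vec_mem] at h2
  rw [h.vec_mem] at h3
  have h4 : F 0 (splitVec A s u 1) = (LinearMap.trace ℂ W (F 0 * A) - s 0) • u := by
    rw [sub_smul, ← h3, h2, add_sub_cancel_left]
  rw [h4, smul_smul, smul_smul, ← add_smul] at h1
  have := smul_left_injective ℂ h.vec_ne h1
  linear_combination -this

/-- The last split vector `v_d` is an eigenvector of `A` for `s_d`. The relation results from
computing `F_d A As v_d` in two ways: through the bidiagonal formula for `As v_d`, and by splitting
`As v_d` into its `F_d` and `F_{d-1}` components. -/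
theorem split_last_dual (h : IsLeonardSystem d A As E F s ss u) (hd : 0 < d) :
    split A As s ss u d =
      (LinearMap.trace ℂ W (F d * A) - s d) * (ss d - ss (d - 1)) := by
  obtain ⟨i, rfl⟩ : ∃ i, d = i + 1 := ⟨d - 1, by omega⟩
  have hne := h.apply_splitVec_ne_zero h.vec_mem h.vec_ne h.ne_zero_dual h.rank_dual le_rfl
  -- The polynomial `τ_{d+1}` vanishes at all `d + 1` eigenvalues.
  have h0 : splitVec A s u (i + 2) = 0 :=
    (h.aeval_eq_zero_iff _).mpr fun j hj => eval_splitPoly_eq_zero s (by omega)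
  have h1 := map_splitVec A s u (i + 1)
  rw [h0, add_zero] at h1
  have h2 := congrArg (fun w => F (i + 1) (A w)) (h.map_splitVec_dual (Nat.lt_succ_self i))
  have h3 := last_apply_map h.toIsTridiagonalSystem hd (splitVec A s u (i + 1))
  have h4 := last_apply_map h.toIsTridiagonalSystem hd (As (splitVec A s u (i + 1)))
  rw [eig_apply h.eigen_dual le_rfl, eig_apply h.eigen_dual (by omega), map_smul, map_smul,
    map_smul, map_smul, h.apply_map_apply_dual le_rfl] at h4
  rw [h1, map_smul, h.apply_map_apply_dual le_rfl] at h3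
  simp only [map_add, map_smul] at h2
  rw [h4, h1, map_splitVec A s u i, map_add, map_smul, map_smul,
    h.toIsTridiagonalSystem.apply_splitVec_eq_zero h.vec_mem (Nat.lt_succ_self i) le_rfl,
    smul_zero, zero_add] at h2
  rw [Nat.add_sub_cancel] at h2 h3 ⊢
  set y := F (i + 1) (splitVec A s u (i + 1)) with hy
  set z := F (i + 1) (A (F i (splitVec A s u (i + 1)))) with hz
  set a := LinearMap.trace ℂ W (F (i + 1) * A) with ha
  have h5 : z = (s (i + 1) - a) • y := by rw [sub_smul, h3, add_sub_cancel_left]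
  rw [h5, smul_smul, smul_smul, smul_smul, ← add_smul, ← add_smul] at h2
  have := smul_left_injective ℂ hne h2
  linear_combination -this

end Scalars

end IsLeonardSystem

/-! ### Isomorphisms -/

section Isomorphism

open IsTridiagonalSystem

variable {W' : Type*} [AddCommGroup W'] [Module ℂ W']
  {d : ℕ} {A As : End ℂ W} {E F : ℕ → End ℂ W} {A' As' : End ℂ W'} {E' F' : ℕ → End ℂ W'}
  {s ss : ℕ → ℂ} {u : W} {u' : W'}

/-- The split sequence and the two eigenvalue sequences determine a Leonard system. -/
theorem IsLeonardSystem.exists_equiv (h : IsLeonardSystem d A As E F s ss u)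
    (h' : IsLeonardSystem d A' As' E' F' s ss u')
    (hs : ∀ i < d, IsLeonardSystem.split A As s ss u (i + 1) =
      IsLeonardSystem.split A' As' s ss u' (i + 1)) :
    ∃ σ : W ≃ₗ[ℂ] W', (∀ w, σ (A w) = A' (σ w)) ∧ ∀ w, σ (As w) = As' (σ w) := by
  let f : ℂ[X] →ₗ[ℂ] W :=
    { toFun := fun p => aeval A p u
      map_add' := by simp
      map_smul' := by simp }
  let f' : ℂ[X] →ₗ[ℂ] W' :=
    { toFun := fun p => aeval A' p u'
      map_add' := by simp
      map_smul' := by simp }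
  have hf : ∀ p : ℂ[X], f p = aeval A p u := fun p => rfl
  have hf' : ∀ p : ℂ[X], f' p = aeval A' p u' := fun p => rfl
  have hsurj : Function.Surjective f :=
    fun w => h.exists_aeval h.vec_mem h.vec_ne h.ne_zero_dual h.rank_dual w
  have hsurj' : Function.Surjective f' :=
    fun w => h'.exists_aeval h'.vec_mem h'.vec_ne h'.ne_zero_dual h'.rank_dual w
  -- Both modules are the same quotient of `ℂ[X]`, so `p(A) u ↦ p(A') u'` is well defined; it
  -- remains to check that it commutes with `As` on the split basis.
  have hker : LinearMap.ker f = LinearMap.ker f' := by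
    ext p
    rw [LinearMap.mem_ker, LinearMap.mem_ker, hf, hf', h.aeval_eq_zero_iff, h'.aeval_eq_zero_iff]
  let σ : W ≃ₗ[ℂ] W' := (f.quotKerEquivOfSurjective hsurj).symm.trans
    ((Submodule.quotEquivOfEq _ _ hker).trans (f'.quotKerEquivOfSurjective hsurj'))
  have hσ : ∀ p : ℂ[X], σ (aeval A p u) = aeval A' p u' := by
    intro p
    have : (f.quotKerEquivOfSurjective hsurj).symm (aeval A p u) =
        Submodule.Quotient.mk p := by
      rw [LinearEquiv.symm_apply_eq]
      rfl
    simp only [σ, LinearEquiv.trans_apply, this, Submodule.quotEquivOfEq_mk]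
    rfl
  have hσv : ∀ i, σ (splitVec A s u i) = splitVec A' s u' i := fun i => hσ _
  refine ⟨σ, fun w => ?_, fun w => ?_⟩
  · obtain ⟨p, rfl⟩ := hsurj w
    have h1 : A (aeval A p u) = aeval A (X * p) u := by simp
    have h2 : A' (aeval A' p u') = aeval A' (X * p) u' := by simp
    rw [hf, h1, hσ, hσ, h2]
  · have hw := h.span_splitVec h.vec_mem h.vec_ne h.ne_zero_dual h.rank_dual w
    induction hw using Submodule.span_induction with
    | mem w hw =>
      obtain ⟨i, hi, rfl⟩ := hw
      have hi : i < d + 1 := hi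
      rcases i with _ | i
      · rw [hσv, splitVec_zero, splitVec_zero, h.map_vec_dual, h'.map_vec_dual, map_smul,
          ← splitVec_zero A s u, hσv, splitVec_zero]
      · rw [h.map_splitVec_dual (by omega), hσv, h'.map_splitVec_dual (by omega), map_add,
          map_smul, map_smul, hσv, hσv, hs i (by omega)]
    | zero => simp
    | add w w' _ _ h1 h2 => simp only [map_add, h1, h2]
    | smul c w _ h1 => simp only [map_smul, h1]

theorem IsLeonardSystem.exists_equiv_of_trace [FiniteDimensional ℂ W] [FiniteDimensional ℂ W']
    (h : IsLeonardSystem d A As E F s ss u)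
    (h' : IsLeonardSystem d A' As' E' F' s ss u')
    (hs : 0 < d → LinearMap.trace ℂ W (E d * As) = LinearMap.trace ℂ W' (E' d * As')) :
    ∃ σ : W ≃ₗ[ℂ] W', (∀ w, σ (A w) = A' (σ w)) ∧ ∀ w, σ (As w) = As' (σ w) := by
  refine h.exists_equiv h' fun i hi => ?_
  apply mul_right_cancel₀ (h.eval_splitPoly_ne_zero hi.le)
  rw [h.split_mul hi, h'.split_mul hi, hs (by omega)]

end Isomorphism

end DRG

end

noncomputable section

namespace DRG

open Polynomial Module Matrix
open scoped ComplexOrder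

variable {V : Type*} [Fintype V] [DecidableEq V]

/-! ### The eigenvalues and dual eigenvalues of a `Q`-polynomial distance-regular graph -/

section Distance

variable {G : SimpleGraph V}

theorem adj_eq_adjMatrix (G : SimpleGraph V) [DecidableRel G.Adj] : adj G = G.adjMatrix ℂ := by
  ext y z
  simp [adj, distMatrix, SimpleGraph.adjMatrix_apply, SimpleGraph.dist_eq_one_iff_adj]

theorem adj_pow_apply_eq_zero {k : ℕ} {y z : V} (h : k < G.dist y z) : (adj G ^ k) y z = 0 := by
  classical
  rw [adj_eq_adjMatrix, SimpleGraph.adjMatrix_pow_apply_eq_card_walk]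
  rw [Nat.cast_eq_zero, Fintype.card_eq_zero_iff]
  refine ⟨fun p => ?_⟩
  have h1 := SimpleGraph.dist_le p.1
  have h2 : p.1.length = k := p.2
  omega

theorem adj_pow_dist_apply_ne_zero (hG : G.Connected) (y z : V) :
    (adj G ^ G.dist y z) y z ≠ 0 := by
  classical
  rw [adj_eq_adjMatrix, SimpleGraph.adjMatrix_pow_apply_eq_card_walk]
  obtain ⟨p, hp⟩ := hG.exists_walk_length_eq_dist y z
  rw [Nat.cast_ne_zero]
  exact (Fintype.card_pos_iff.mpr ⟨⟨p, hp⟩⟩).ne'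

theorem dist_le_diam (hG : G.Connected) (y z : V) : G.dist y z ≤ G.diam := by
  have := hG.nonempty
  exact SimpleGraph.dist_le_diam (SimpleGraph.connected_iff_ediam_ne_top.mp hG)

theorem exists_dist_eq (hG : G.Connected) {i : ℕ} (hi : i ≤ G.diam) : ∃ y z, G.dist y z = i := by
  have := hG.nonempty
  obtain ⟨y, z, hyz⟩ := G.exists_dist_eq_diam
  obtain ⟨p, hp⟩ := hG.exists_walk_length_eq_dist y z
  refine ⟨y, p.getVert i, ?_⟩
  have h1 := SimpleGraph.dist_le (p.take i)
  have h2 := SimpleGraph.dist_le (p.drop i)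
  have h3 := hG.dist_triangle (u := y) (v := p.getVert i) (w := z)
  rw [SimpleGraph.Walk.take_length] at h1
  rw [SimpleGraph.Walk.drop_length] at h2
  omega

/-- The number of vertices at distance `i` from a base vertex is `p 0 i i`, the same for every base
vertex, and some base vertex has one. -/
theorem IsDistanceRegular.exists_dist_eq (hG : IsDistanceRegular G) (x : V) {i : ℕ}
    (hi : i ≤ G.diam) : ∃ y, G.dist x y = i := by
  obtain ⟨y, z, hyz⟩ := DRG.exists_dist_eq hG.connected hi
  obtain ⟨p, hp⟩ := hG.exists_intersectionNumbers
  have h1 := hp y y i i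
  have h2 := hp x x i i
  simp only [and_self, SimpleGraph.dist_self] at h1 h2
  have h3 : {w | G.dist x w = i}.ncard ≠ 0 := by
    rw [h2, ← h1]
    exact (Set.ncard_pos (Set.toFinite _)).mpr ⟨z, hyz⟩ |>.ne'
  exact Set.nonempty_of_ncard_ne_zero h3

theorem adj_mem_boseMesner (G : SimpleGraph V) : adj G ∈ boseMesner G :=
  Submodule.subset_span ⟨1, rfl⟩

theorem apply_eq_of_mem_boseMesner {B : Matrix V V ℂ} (hB : B ∈ boseMesner G) {y z y' z' : V}
    (h : G.dist y z = G.dist y' z') : B y z = B y' z' := by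
  induction hB using Submodule.span_induction with
  | mem B hB =>
    obtain ⟨i, rfl⟩ := hB
    simp [distMatrix, h]
  | zero => rfl
  | add B C _ _ h1 h2 => rw [Matrix.add_apply, Matrix.add_apply, h1, h2]
  | smul c B _ h1 => rw [Matrix.smul_apply, Matrix.smul_apply, h1]

theorem dualIdempotent_mul_mul_eq_zero (hG : G.Connected) (x : V) {i j : ℕ}
    (hij : i + 1 < j ∨ j + 1 < i) :
    dualIdempotent G x i * adj G * dualIdempotent G x j = 0 := by
  ext y z
  rw [dualIdempotent, dualIdempotent, mul_diagonal, diagonal_mul, adj, distMatrix, of_apply,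
    Matrix.zero_apply]
  have h1 := hG.dist_triangle (u := x) (v := y) (w := z)
  have h2 := hG.dist_triangle (u := x) (v := z) (w := y)
  rw [SimpleGraph.dist_comm (u := z)] at h2
  split_ifs <;> first | omega | simp

end Distance

/-! ### Distinct eigenvalues, triple products and generators of `T` -/

section Idempotents

variable {G : SimpleGraph V} {E : ℕ → Matrix V V ℂ}

theorem IsIdempotentOrdering.mem_boseMesner (hE : IsIdempotentOrdering G E) {i : ℕ}
    (hi : i ≤ G.diam) : E i ∈ boseMesner G := by
  rw [← hE.span_eq]
  exact Submodule.subset_span ⟨i, hi, rfl⟩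

theorem IsIdempotentOrdering.ne_zero (hE : IsIdempotentOrdering G E) {i : ℕ} (hi : i ≤ G.diam) :
    E i ≠ 0 := hE.linearIndependent.ne_zero (⟨i, by omega⟩ : Fin (G.diam + 1))

theorem IsIdempotentOrdering.exists_mul_eq_smul (hE : IsIdempotentOrdering G E)
    {B : Matrix V V ℂ} (hB : B ∈ boseMesner G) {i : ℕ} (hi : i ≤ G.diam) :
    ∃ c : ℂ, B * E i = c • E i := by
  rw [← hE.span_eq] at hB
  induction hB using Submodule.span_induction with
  | mem B hB =>
    obtain ⟨j, hj, rfl⟩ := hB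
    rw [hE.mul_eq j hj i hi]
    split_ifs with h
    · exact ⟨1, by rw [h, one_smul]⟩
    · exact ⟨0, by rw [zero_smul]⟩
  | zero => exact ⟨0, by simp⟩
  | add B C _ _ h1 h2 =>
    obtain ⟨b, hb⟩ := h1
    obtain ⟨c, hc⟩ := h2
    exact ⟨b + c, by rw [add_mul, hb, hc, add_smul]⟩
  | smul a B _ h1 =>
    obtain ⟨b, hb⟩ := h1
    exact ⟨a * b, by rw [smul_mul_assoc, hb, smul_smul]⟩

theorem img_top_ne_bot {B : Matrix V V ℂ} (hB : B ≠ 0) : img B ⊤ ≠ ⊥ := by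
  intro h
  apply hB
  rw [img, Submodule.map_top, LinearMap.range_eq_bot] at h
  ext y z
  have := congrFun (congrArg (fun f : (V → ℂ) →ₗ[ℂ] V → ℂ => f (Pi.single z 1)) h) y
  simpa using this

theorem eigenvalueOn_img_top {A B : Matrix V V ℂ} (hB : B ≠ 0) {c : ℂ} (h : A * B = c • B) :
    eigenvalueOn A (img B ⊤) = c := by
  apply eigenvalueOn_eq (img_top_ne_bot hB)
  rintro _ ⟨v, -, rfl⟩
  rw [mulVecLin_apply, mulVec_mulVec, h, smul_mulVec]

theorem IsIdempotentOrdering.adj_mul (hE : IsIdempotentOrdering G E) {i : ℕ} (hi : i ≤ G.diam) :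
    adj G * E i = theta G E i • E i := by
  obtain ⟨c, hc⟩ := hE.exists_mul_eq_smul (adj_mem_boseMesner G) hi
  rw [theta, eigenvalueOn_img_top (hE.ne_zero hi) hc, hc]

/-- At an entry `(y, z)` whose distance is the degree of `p`, only the leading term contributes, and
it counts geodesics. -/
theorem aeval_adj_ne_zero (hG : G.Connected) {p : ℂ[X]} (hp : p.Monic)
    (hd : p.natDegree ≤ G.diam) : aeval (adj G) p ≠ 0 := by
  obtain ⟨y, z, hyz⟩ := exists_dist_eq hG hd
  intro h0
  have h1 := congrFun (congrFun h0 y) z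
  rw [aeval_eq_sum_range, Matrix.sum_apply, Finset.sum_range_succ, Finset.sum_eq_zero, zero_add,
    hp.coeff_natDegree, one_smul] at h1
  · exact adj_pow_dist_apply_ne_zero hG y z (hyz ▸ h1)
  · intro k hk
    rw [Matrix.smul_apply, adj_pow_apply_eq_zero (by grind), smul_zero]

/-- The eigenvalues `θ_0, …, θ_D` are mutually distinct. -/
theorem IsIdempotentOrdering.isEigenSystem (hE : IsIdempotentOrdering G E) (hG : G.Connected) :
    IsEigenSystem G.diam (adj G) E (theta G E) where
  mul_eq := hE.mul_eq
  sum_eq := hE.sum_eq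
  eig i hi := hE.adj_mul hi
  inj := by
    classical
    set S : Finset ℂ := (Finset.range (G.diam + 1)).image (theta G E) with hS
    have hcard : S.card = (Finset.range (G.diam + 1)).card := by
      refine le_antisymm Finset.card_image_le ?_
      by_contra! hlt
      rw [Finset.card_range] at hlt
      -- With a repeated eigenvalue, this monic polynomial would have degree at most the diameter
      -- and yet annihilate `A`.
      refine aeval_adj_ne_zero hG (p := ∏ a ∈ S, (X - C a))
        (monic_prod_of_monic _ _ fun a _ => monic_X_sub_C a) ?_ ?_
      · rw [natDegree_prod_of_monic _ _ fun a _ => monic_X_sub_C a]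
        simp only [natDegree_X_sub_C, Finset.sum_const, smul_eq_mul, mul_one]
        omega
      · set p : ℂ[X] := ∏ a ∈ S, (X - C a) with hp
        rw [← mul_one (aeval (adj G) p), ← hE.sum_eq, Finset.mul_sum]
        refine Finset.sum_eq_zero fun i hi => ?_
        rw [aeval_mul_of_mul_eq (hE.adj_mul (by grind)), hp, eval_prod,
          Finset.prod_eq_zero (i := theta G E i) (Finset.mem_image_of_mem _ hi) (by simp),
          zero_smul]
    have hinj := Finset.card_image_iff.mp hcard
    intro i hi j hj hij
    exact hinj (by simpa using Nat.lt_succ_of_le hi) (by simpa using Nat.lt_succ_of_le hj) hij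

/-- For a `Q`-polynomial ordering, the entries of `E_1` determine those of all `E_m`. -/
theorem IsQPolynomial.apply_eq (hQ : IsQPolynomial G E) (hE : IsIdempotentOrdering G E)
    (hD : 1 ≤ G.diam) {y z y' z' : V} (h : E 1 y z = E 1 y' z') {m : ℕ} (hm : m ≤ G.diam) :
    E m y z = E m y' z' := by
  obtain ⟨q, hq, hq'⟩ := hQ
  have : Nonempty V := ⟨y⟩
  have hcard : (Fintype.card V : ℂ) ≠ 0 := Nat.cast_ne_zero.mpr Fintype.card_ne_zero
  induction m using Nat.strong_induction_on with
  | _ m ih =>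
    rcases m with _ | m
    · simp [hE.zero_eq]
    -- The expansion of `E_1 ∘ E_m` stops at `h = m + 1`, which gives a recursion for the entries of
    -- `E (m + 1)`; its leading Krein parameter is nonzero.
    have key : ∀ v w, q (m + 1) 1 m * E (m + 1) v w = Fintype.card V * (E 1 v w * E m v w) -
        ∑ k ∈ Finset.range (m + 1), q k 1 m * E k v w := by
      intro v w
      have h1 := congrFun (congrFun (hq 1 hD m (by omega)) v) w
      rw [hadamard_apply, Matrix.smul_apply, Matrix.sum_apply, smul_eq_mul,
        ← Finset.sum_subset (Finset.range_subset_range.mpr (show m + 2 ≤ G.diam + 1 by omega)),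
        Finset.sum_range_succ] at h1
      · simp only [Matrix.smul_apply, smul_eq_mul] at h1
        rw [h1, mul_inv_cancel_left₀ hcard]
        ring
      · intro k hk hk'
        rw [(hq' k (by grind) 1 hD m (by omega)).1 (by grind), zero_smul, Matrix.zero_apply]
    have hne : q (m + 1) 1 m ≠ 0 := (hq' (m + 1) hm 1 hD m (by omega)).2 (by omega)
    apply mul_left_cancel₀ hne
    rw [key, key, h, ih m (by omega) (by omega)]
    congr 1
    refine Finset.sum_congr rfl fun k hk => ?_
    rw [ih k (by grind) (by grind)]

/-- Equal entries of `E_1` force equal entries of all `E_m`, hence of everything in the Bose–Mesner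
algebra, and the distance matrices tell distances apart. -/
theorem dist_eq_of_apply_eq (hQ : IsQPolynomial G E) (hE : IsIdempotentOrdering G E)
    (hD : 1 ≤ G.diam) {y z y' z' : V} (h : E 1 y z = E 1 y' z') :
    G.dist y z = G.dist y' z' := by
  have key : ∀ B ∈ boseMesner G, B y z = B y' z' := by
    intro B hB
    rw [← hE.span_eq] at hB
    induction hB using Submodule.span_induction with
    | mem B hB =>
      obtain ⟨i, hi, rfl⟩ := hB
      exact hQ.apply_eq hE hD h hi
    | zero => rfl
    | add B C _ _ h1 h2 => rw [Matrix.add_apply, Matrix.add_apply, h1, h2]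
    | smul c B _ h1 => rw [Matrix.smul_apply, Matrix.smul_apply, h1]
  have := key (distMatrix G (G.dist y z)) (Submodule.subset_span ⟨_, rfl⟩)
  simp only [distMatrix, of_apply, if_true] at this
  by_contra hne
  rw [if_neg (Ne.symm hne)] at this
  exact one_ne_zero this

theorem dualIdempotent_ne_zero (hG : IsDistanceRegular G) (x : V) {i : ℕ} (hi : i ≤ G.diam) :
    dualIdempotent G x i ≠ 0 := by
  obtain ⟨y, hy⟩ := hG.exists_dist_eq x hi
  intro h0
  have := congrFun (congrFun h0 y) y
  simp [dualIdempotent, hy] at this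

theorem dualTheta_eq (hG : IsDistanceRegular G) (hE : IsIdempotentOrdering G E)
    (hD : 1 ≤ G.diam) (x y : V) :
    dualTheta G x E (G.dist x y) = Fintype.card V * E 1 x y := by
  refine eigenvalueOn_img_top
    (dualIdempotent_ne_zero hG x (dist_le_diam hG.connected x y)) ?_
  rw [dualAdj, dualIdempotent, diagonal_mul_diagonal, ← diagonal_smul]
  congr 1
  ext z
  simp only [Pi.smul_apply, smul_eq_mul]
  split_ifs with h
  · rw [apply_eq_of_mem_boseMesner (hE.mem_boseMesner hD) h]
  · simp

/-- The dual eigenvalues `θ*_0, …, θ*_D` are mutually distinct. -/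
theorem isEigenSystem_dual (hG : IsDistanceRegular G) (hE : IsIdempotentOrdering G E)
    (hQ : IsQPolynomial G E) (hD : 1 ≤ G.diam) (x : V) :
    IsEigenSystem G.diam (dualAdj x E) (dualIdempotent G x) (dualTheta G x E) where
  mul_eq i _ j _ := by
    rw [dualIdempotent, dualIdempotent, diagonal_mul_diagonal]
    split_ifs with h
    · subst h
      simp
    · rw [← diagonal_zero]
      congr 1
      ext y
      by_cases h1 : G.dist x y = i <;> simp [h1, h]
  sum_eq := by
    ext y z
    rw [Matrix.sum_apply]
    by_cases hyz : y = z
    · subst hyz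
      simp [dualIdempotent, Nat.lt_succ_of_le (dist_le_diam hG.connected x y)]
    · simp [dualIdempotent, hyz]
  eig i hi := by
    obtain ⟨y, rfl⟩ := hG.exists_dist_eq x hi
    rw [dualTheta_eq hG hE hD, dualAdj, dualIdempotent, diagonal_mul_diagonal, ← diagonal_smul]
    congr 1
    ext z
    simp only [Pi.smul_apply, smul_eq_mul]
    split_ifs with h
    · rw [apply_eq_of_mem_boseMesner (hE.mem_boseMesner hD) h]
    · simp
  inj i hi j hj hij := by
    obtain ⟨y, rfl⟩ := hG.exists_dist_eq x hi
    obtain ⟨z, rfl⟩ := hG.exists_dist_eq x hj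
    have : Nonempty V := ⟨x⟩
    rw [dualTheta_eq hG hE hD, dualTheta_eq hG hE hD] at hij
    exact dist_eq_of_apply_eq hQ hE hD
      (mul_left_cancel₀ (Nat.cast_ne_zero.mpr Fintype.card_ne_zero) hij)

theorem trace_mul_diagonal_mul_mul_diagonal (A B : Matrix V V ℂ) (f g : V → ℂ) :
    trace (A * diagonal f * B * diagonal g) = ∑ y, ∑ z, A y z * f z * B z y * g y := by
  simp only [trace, diag_apply]
  refine Finset.sum_congr rfl fun y _ => ?_
  rw [mul_diagonal, Matrix.mul_apply, Finset.sum_mul]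
  exact Finset.sum_congr rfl fun z _ => by rw [mul_diagonal]

/-- The squared Frobenius norm of `E_i A* E_j` is `tr(E_i A* E_j A*) = |V| ∑_h q^h_{ij} (E_1 E_h
E_1)_{xx}`. Only `h = 1` survives, and `q^1_{ij} = 0` by the triangle condition. -/
theorem idempotent_mul_dualAdj_mul_eq_zero (hE : IsIdempotentOrdering G E)
    (hQ : IsQPolynomial G E) (hD : 1 ≤ G.diam) (x : V) {i j : ℕ} (hi : i ≤ G.diam)
    (hj : j ≤ G.diam) (hij : i + 1 < j ∨ j + 1 < i) : E i * dualAdj x E * E j = 0 := by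
  have hreal : ∀ k ≤ G.diam, ∀ y z, star (E k y z) = E k y z := fun k hk y z =>
    congrFun (congrFun (hE.conj_eq k hk) y) z
  have hsymm : ∀ k ≤ G.diam, ∀ y z, E k y z = E k z y := fun k hk y z =>
    congrFun (congrFun (hE.transpose_eq k hk) z) y
  have hherm : ∀ k ≤ G.diam, (E k)ᴴ = E k := by
    intro k hk
    ext y z
    rw [conjTranspose_apply, hreal k hk, hsymm k hk]
  have hdiag : (dualAdj x E)ᴴ = dualAdj x E := by
    rw [dualAdj, diagonal_conjTranspose]
    congr 1
    ext y
    rw [Pi.star_apply, star_mul', hreal 1 hD, star_natCast]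
  obtain ⟨q, hq, hq'⟩ := hQ
  rw [← trace_mul_conjTranspose_self_eq_zero_iff]
  rw [conjTranspose_mul, conjTranspose_mul, hherm i hi, hherm j hj, hdiag]
  have h1 : trace (E i * dualAdj x E * E j * (E j * (dualAdj x E * E i))) =
      trace (E i * dualAdj x E * E j * dualAdj x E) := by
    rw [← mul_assoc, mul_assoc _ (E j) (E j), hE.mul_eq j hj j hj, if_pos rfl, ← mul_assoc,
      trace_mul_comm, ← mul_assoc, ← mul_assoc, ← mul_assoc, hE.mul_eq i hi i hi, if_pos rfl]
  rw [h1, dualAdj, trace_mul_diagonal_mul_mul_diagonal]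
  have h2 : ∀ y z, E i y z * E j z y =
      (Fintype.card V : ℂ)⁻¹ * ∑ h ∈ Finset.range (G.diam + 1), q h i j * E h y z := by
    intro y z
    have := congrFun (congrFun (hq i hi j hj) y) z
    rw [hadamard_apply, Matrix.smul_apply, Matrix.sum_apply] at this
    rw [hsymm j hj z y, this]
    simp
  have h3 : ∀ h ∈ Finset.range (G.diam + 1),
      q h i j * ∑ y, ∑ z, E 1 x y * E h y z * E 1 z x = 0 := by
    intro h hh
    have hh : h ≤ G.diam := by grind
    have h4 : ∑ y, ∑ z, E 1 x y * E h y z * E 1 z x = (E 1 * E h * E 1) x x := by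
      rw [Matrix.mul_apply]
      rw [Finset.sum_comm]
      refine Finset.sum_congr rfl fun z _ => ?_
      rw [Matrix.mul_apply, Finset.sum_mul]
    rw [h4, hE.mul_eq 1 hD h hh]
    split_ifs with h5
    · subst h5
      rw [(hq' 1 hD i hi j hj).1 (by omega), zero_mul]
    · simp
  calc ∑ y, ∑ z, E i y z * ((Fintype.card V : ℂ) * E 1 x z) * E j z y *
        ((Fintype.card V : ℂ) * E 1 x y)
      = ∑ y, ∑ z, (Fintype.card V : ℂ) ^ 2 * (Fintype.card V : ℂ)⁻¹ *
          ∑ h ∈ Finset.range (G.diam + 1), q h i j * (E 1 x y * E h y z * E 1 z x) := by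
        refine Finset.sum_congr rfl fun y _ => Finset.sum_congr rfl fun z _ => ?_
        have h5 : E i y z * ((Fintype.card V : ℂ) * E 1 x z) * E j z y *
            ((Fintype.card V : ℂ) * E 1 x y) = (Fintype.card V : ℂ) ^ 2 * (E 1 x y * E 1 z x) *
              (E i y z * E j z y) := by
          rw [hsymm 1 hD z x]
          ring
        rw [h5, h2, Finset.mul_sum, Finset.mul_sum, Finset.mul_sum]
        exact Finset.sum_congr rfl fun h _ => by ring
    _ = (Fintype.card V : ℂ) ^ 2 * (Fintype.card V : ℂ)⁻¹ *
          ∑ h ∈ Finset.range (G.diam + 1),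
            q h i j * ∑ y, ∑ z, E 1 x y * E h y z * E 1 z x := by
        simp only [Finset.mul_sum]
        rw [Finset.sum_comm (s := Finset.range (G.diam + 1))]
        refine Finset.sum_congr rfl fun y _ => ?_
        rw [Finset.sum_comm]
    _ = 0 := by rw [Finset.sum_eq_zero h3, mul_zero]

/-- The Terwilliger algebra is generated by `A` and `A*`. -/
theorem terwilliger_eq_adjoin (hG : IsDistanceRegular G) (hE : IsIdempotentOrdering G E)
    (hQ : IsQPolynomial G E) (hD : 1 ≤ G.diam) (x : V) :
    terwilliger G x = Algebra.adjoin ℂ {adj G, dualAdj x E} := by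
  have hF := isEigenSystem_dual hG hE hQ hD x
  have hM := hE.isEigenSystem hG.connected
  apply le_antisymm
  · refine Algebra.adjoin_le ?_
    rintro B (hB | hB)
    · rw [SetLike.mem_coe, ← hE.span_eq] at hB
      refine (Submodule.span_le (p := Subalgebra.toSubmodule (Algebra.adjoin ℂ {adj G, dualAdj x E}))).mpr ?_ hB
      rintro _ ⟨i, hi, rfl⟩
      -- Each `E_i` is a polynomial in `A`; below, each `E*_i` is likewise a polynomial in `A*`.
      -- Both use distinctness of the eigenvalues.
      exact Algebra.adjoin_mono (by simp) (hM.mem_adjoin hi)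
    · refine (Submodule.span_le (p := Subalgebra.toSubmodule (Algebra.adjoin ℂ {adj G, dualAdj x E}))).mpr ?_ hB
      rintro _ ⟨i, rfl⟩
      by_cases hi : i ≤ G.diam
      · exact Algebra.adjoin_mono (by simp) (hF.mem_adjoin hi)
      · have : dualIdempotent G x i = 0 := by
          rw [dualIdempotent, ← diagonal_zero]
          congr 1
          ext y
          have := dist_le_diam hG.connected x y
          rw [if_neg (by omega)]
        rw [this]
        exact Submodule.zero_mem _
  · refine Algebra.adjoin_le ?_
    rintro B (rfl | rfl)
    · exact Algebra.subset_adjoin (Or.inl (adj_mem_boseMesner G))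
    · rw [hF.eq_sum]
      refine sum_mem fun i _ => Subalgebra.smul_mem _ ?_ _
      exact Algebra.subset_adjoin (Or.inr (Submodule.subset_span ⟨i, rfl⟩))

theorem adj_mem_terwilliger (G : SimpleGraph V) (x : V) : adj G ∈ terwilliger G x :=
  Algebra.subset_adjoin (Or.inl (adj_mem_boseMesner G))

theorem IsIdempotentOrdering.mem_terwilliger (hE : IsIdempotentOrdering G E) (x : V) {i : ℕ}
    (hi : i ≤ G.diam) : E i ∈ terwilliger G x :=
  Algebra.subset_adjoin (Or.inl (hE.mem_boseMesner hi))

theorem dualIdempotent_mem_terwilliger (G : SimpleGraph V) (x : V) (i : ℕ) :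
    dualIdempotent G x i ∈ terwilliger G x :=
  Algebra.subset_adjoin (Or.inr (Submodule.subset_span ⟨i, rfl⟩))

theorem dualAdj_mem_terwilliger (hG : IsDistanceRegular G) (hE : IsIdempotentOrdering G E)
    (hQ : IsQPolynomial G E) (hD : 1 ≤ G.diam) (x : V) : dualAdj x E ∈ terwilliger G x := by
  rw [terwilliger_eq_adjoin hG hE hQ hD]
  exact Algebra.subset_adjoin (by simp)

end Idempotents

end DRG

end

noncomputable section

namespace DRG

open Polynomial Module Matrix

variable {V : Type*} [Fintype V] [DecidableEq V]

/-! ### The action of matrices on an invariant subspace -/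

open Classical in
/-- The action of `B` on `W` if `BW ⊆ W`, and `0` otherwise. -/
def restr (W : Submodule ℂ (V → ℂ)) (B : Matrix V V ℂ) : End ℂ W :=
  if h : ∀ w ∈ W, B.mulVecLin w ∈ W then B.mulVecLin.restrict h else 0

section Restr

variable {W : Submodule ℂ (V → ℂ)} {A B : Matrix V V ℂ}

theorem trace_restr (W : Submodule ℂ (V → ℂ)) (B : Matrix V V ℂ) :
    traceOn W B = LinearMap.trace ℂ W (restr W B) := by
  unfold traceOn restr
  split_ifs
  · rfl
  · rw [map_zero]

theorem restr_apply (hB : ∀ w ∈ W, B *ᵥ w ∈ W) (w : W) : (restr W B w : V → ℂ) = B *ᵥ w := by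
  have : ∀ w ∈ W, B.mulVecLin w ∈ W := hB
  rw [restr, dif_pos this]
  rfl

theorem restr_mul (hA : ∀ w ∈ W, A *ᵥ w ∈ W) (hB : ∀ w ∈ W, B *ᵥ w ∈ W) :
    restr W (A * B) = restr W A * restr W B := by
  have hAB : ∀ w ∈ W, (A * B) *ᵥ w ∈ W := fun w hw => by
    rw [← mulVec_mulVec]
    exact hA _ (hB w hw)
  ext1 w
  apply Subtype.ext
  rw [restr_apply hAB, Module.End.mul_apply, restr_apply hA, restr_apply hB, mulVec_mulVec]

theorem restr_zero : restr W 0 = 0 := by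
  ext1 w
  apply Subtype.ext
  rw [restr_apply (by simp)]
  simp

theorem restr_smul (hB : ∀ w ∈ W, B *ᵥ w ∈ W) (c : ℂ) : restr W (c • B) = c • restr W B := by
  ext1 w
  apply Subtype.ext
  rw [restr_apply, LinearMap.smul_apply, Submodule.coe_smul, restr_apply hB, smul_mulVec]
  intro w hw
  rw [smul_mulVec]
  exact W.smul_mem _ (hB w hw)

theorem restr_aeval (hA : ∀ w ∈ W, A *ᵥ w ∈ W) (p : ℂ[X]) (w : W) :
    (aeval (restr W A) p w : V → ℂ) = aeval A p *ᵥ w := by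
  induction p using Polynomial.induction_on' with
  | add p q hp hq => simp [add_mulVec, hp, hq]
  | monomial k a =>
    rw [aeval_monomial, aeval_monomial, ← Algebra.smul_def, ← Algebra.smul_def,
      LinearMap.smul_apply, Submodule.coe_smul, smul_mulVec]
    congr 1
    induction k with
    | zero => simp
    | succ k ih => rw [pow_succ', pow_succ', Module.End.mul_apply, restr_apply hA, ih,
        mulVec_mulVec]

theorem IsEigenSystem.restr {n : ℕ} {E : ℕ → Matrix V V ℂ} {s : ℕ → ℂ}
    (h : IsEigenSystem n A E s) (hA : ∀ w ∈ W, A *ᵥ w ∈ W)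
    (hE : ∀ i ≤ n, ∀ w ∈ W, E i *ᵥ w ∈ W) :
    IsEigenSystem n (DRG.restr W A) (fun i => DRG.restr W (E i)) s where
  mul_eq i hi j hj := by
    rw [← restr_mul (hE i hi) (hE j hj), h.mul_eq i hi j hj]
    split_ifs
    · rfl
    · exact restr_zero
  sum_eq := by
    ext1 w
    apply Subtype.ext
    rw [LinearMap.sum_apply, Submodule.coe_sum,
      Finset.sum_congr rfl fun i hi => restr_apply (hE i (by grind)) w, ← sum_mulVec, h.sum_eq]
    simp
  eig i hi := by
    rw [← restr_mul hA (hE i hi), h.eig i hi, restr_smul (hE i hi)]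
  inj := h.inj

theorem restr_ne_zero_iff (hB : ∀ w ∈ W, B *ᵥ w ∈ W) : restr W B ≠ 0 ↔ img B W ≠ ⊥ := by
  rw [not_iff_not, img, ← LinearMap.le_ker_iff_map]
  constructor
  · intro h w hw
    have := congrArg (fun f : End ℂ W => (f ⟨w, hw⟩ : V → ℂ)) h
    simp only [restr_apply hB] at this
    simpa using this
  · intro h
    ext1 w
    apply Subtype.ext
    rw [restr_apply hB]
    simpa using h w.2

theorem rankLEOne_restr (hB : ∀ w ∈ W, B *ᵥ w ∈ W) (h : finrank ℂ (img B W) ≤ 1) :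
    RankLEOne (restr W B) := by
  intro w w' hw
  obtain ⟨⟨v, hv⟩, hv'⟩ := finrank_le_one_iff.mp h
  obtain ⟨a, ha⟩ := hv' ⟨B *ᵥ w, w, w.2, rfl⟩
  obtain ⟨b, hb⟩ := hv' ⟨B *ᵥ w', w', w'.2, rfl⟩
  have ha : a • v = restr W B w := (congrArg Subtype.val ha).trans (restr_apply hB w).symm
  have hb : b • v = restr W B w' := (congrArg Subtype.val hb).trans (restr_apply hB w').symm
  have ha0 : a ≠ 0 := by
    rintro rfl
    exact hw (Subtype.ext (by rw [← ha, zero_smul]; rfl))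
  refine ⟨b * a⁻¹, Subtype.ext ?_⟩
  rw [Submodule.coe_smul, ← ha, ← hb, smul_smul, mul_assoc, inv_mul_cancel₀ ha0, mul_one]

end Restr

/-! ### Thin irreducible modules as Leonard systems -/

section Module

variable {G : SimpleGraph V} {E : ℕ → Matrix V V ℂ} {x : V} {W W' : Submodule ℂ (V → ℂ)}

theorem IsTModule.mulVec_mem (hW : IsTModule G x W) {B : Matrix V V ℂ}
    (hB : B ∈ terwilliger G x) : ∀ w ∈ W, B *ᵥ w ∈ W := hW B hB

theorem setOf_img_dualIdempotent_ne_bot (hW : IsTModule G x W) :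
    {i | i ≤ G.diam ∧ img (dualIdempotent G x i) W ≠ ⊥} =
      {i | i ≤ G.diam ∧ restr W (dualIdempotent G x i) ≠ 0} := by
  ext i
  exact and_congr_right fun _ =>
    (restr_ne_zero_iff (hW.mulVec_mem (dualIdempotent_mem_terwilliger G x i))).symm

theorem setOf_img_idempotent_ne_bot (hE : IsIdempotentOrdering G E) (hW : IsTModule G x W) :
    {i | i ≤ G.diam ∧ img (E i) W ≠ ⊥} = {i | i ≤ G.diam ∧ restr W (E i) ≠ 0} := by
  ext i
  exact and_congr_right fun hi =>
    (restr_ne_zero_iff (hW.mulVec_mem (hE.mem_terwilliger x hi))).symm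

theorem IsThinIrreducible.isTridiagonalSystem (hW : IsThinIrreducible G x W)
    (hG : IsDistanceRegular G) (hE : IsIdempotentOrdering G E) (hQ : IsQPolynomial G E)
    (hD : 1 ≤ G.diam) :
    IsTridiagonalSystem G.diam G.diam (restr W (adj G)) (restr W (dualAdj x E))
      (fun i => restr W (E i)) (fun i => restr W (dualIdempotent G x i)) (theta G E)
      (dualTheta G x E) := by
  have hA := hW.isTModule.mulVec_mem (adj_mem_terwilliger G x)
  have hAs := hW.isTModule.mulVec_mem (dualAdj_mem_terwilliger hG hE hQ hD x)
  have hEi := fun i (hi : i ≤ G.diam) => hW.isTModule.mulVec_mem (hE.mem_terwilliger x hi)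
  have hFi := fun i => hW.isTModule.mulVec_mem (dualIdempotent_mem_terwilliger G x i)
  have hmul : ∀ {B C : Matrix V V ℂ}, B ∈ terwilliger G x → C ∈ terwilliger G x →
      restr W B * restr W C = restr W (B * C) := fun hB hC =>
    (restr_mul (hW.isTModule.mulVec_mem hB) (hW.isTModule.mulVec_mem hC)).symm
  have hAT := adj_mem_terwilliger G x
  have hAsT := dualAdj_mem_terwilliger hG hE hQ hD x
  refine ⟨(hE.isEigenSystem hG.connected).restr hA hEi,
    (isEigenSystem_dual hG hE hQ hD x).restr hAs fun i _ => hFi i, ?_, ?_, ?_⟩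
  · intro i _ j _ hij
    have hi := dualIdempotent_mem_terwilliger G x i
    rw [hmul hi hAT, hmul (mul_mem hi hAT) (dualIdempotent_mem_terwilliger G x j),
      dualIdempotent_mul_mul_eq_zero hG.connected x hij, restr_zero]
  · intro i hi j hj hij
    have hi' := hE.mem_terwilliger x hi
    rw [hmul hi' hAsT, hmul (mul_mem hi' hAsT) (hE.mem_terwilliger x hj),
      idempotent_mul_dualAdj_mul_eq_zero hE hQ hD x hi hj hij, restr_zero]
  · intro U hU hUs
    have hUA : ∀ w ∈ U.map W.subtype, adj G *ᵥ w ∈ U.map W.subtype := by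
      rintro _ ⟨w, hw, rfl⟩
      exact ⟨_, hU w hw, restr_apply hA w⟩
    have hUAs : ∀ w ∈ U.map W.subtype, dualAdj x E *ᵥ w ∈ U.map W.subtype := by
      rintro _ ⟨w, hw, rfl⟩
      exact ⟨_, hUs w hw, restr_apply hAs w⟩
    -- Stability under the two generators of `T` is enough, so irreducibility for `T` is
    -- irreducibility for the pair.
    have hT : IsTModule G x (U.map W.subtype) := by
      intro B hB
      rw [terwilliger_eq_adjoin hG hE hQ hD] at hB
      induction hB using Algebra.adjoin_induction with
      | mem B hB =>
        rcases hB with rfl | rfl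
        · exact hUA
        · exact hUAs
      | algebraMap c =>
        intro w hw
        rw [Algebra.algebraMap_eq_smul_one, smul_mulVec, one_mulVec]
        exact Submodule.smul_mem _ _ hw
      | add B C _ _ hB hC =>
        intro w hw
        rw [add_mulVec]
        exact Submodule.add_mem _ (hB w hw) (hC w hw)
      | mul B C _ _ hB hC =>
        intro w hw
        rw [← mulVec_mulVec]
        exact hB _ (hC w hw)
    rcases hW.irreducible _ (Submodule.map_subtype_le W U) hT with h | h
    · left
      apply Submodule.map_injective_of_injective W.injective_subtype
      rw [h, Submodule.map_bot]
    · right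
      apply Submodule.map_injective_of_injective W.injective_subtype
      rw [h, Submodule.map_subtype_top]

/-- The supports of the `E*_i` and of the `E_i` on `W` are intervals. They have the same length
because both families consist of idempotents of rank at most one, so each has `dim W` nonzero
members. -/
theorem IsThinIrreducible.exists_isLeonardSystem (hW : IsThinIrreducible G x W)
    (hG : IsDistanceRegular G) (hE : IsIdempotentOrdering G E) (hQ : IsQPolynomial G E)
    (hD : 1 ≤ G.diam) :
    dualEndpoint G E W + diameter G x W ≤ G.diam ∧
    ∃ u : W, IsLeonardSystem (diameter G x W) (restr W (adj G)) (restr W (dualAdj x E))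
      (fun i => restr W (E (dualEndpoint G E W + i)))
      (fun i => restr W (dualIdempotent G x (endpoint G x W + i)))
      (fun i => theta G E (dualEndpoint G E W + i))
      (fun i => dualTheta G x E (endpoint G x W + i)) u := by
  have h := hW.isTridiagonalSystem hG hE hQ hD
  set d := diameter G x W with hd
  set r := endpoint G x W with hr
  set t := dualEndpoint G E W with ht
  rw [diameter, setOf_img_dualIdempotent_ne_bot hW.isTModule] at hd
  rw [endpoint, setOf_img_dualIdempotent_ne_bot hW.isTModule] at hr
  rw [dualEndpoint, setOf_img_idempotent_ne_bot hE hW.isTModule] at ht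
  have hrank : ∀ i ≤ G.diam, RankLEOne (restr W (dualIdempotent G x i)) := fun i hi =>
    rankLEOne_restr (hW.isTModule.mulVec_mem (dualIdempotent_mem_terwilliger G x i))
      (hW.thin i hi)
  have hcard := h.eigen_dual.finrank_eq hrank
  have : Nontrivial W := Submodule.nontrivial_iff_ne_bot.mpr hW.ne_bot
  have hpos : 0 < finrank ℂ W := finrank_pos
  -- Since `W ≠ 0`, the truncated subtraction in `diameter` loses nothing.
  have hFcard : {i | i ≤ G.diam ∧ restr W (dualIdempotent G x i) ≠ 0}.ncard = d + 1 := by omega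
  obtain ⟨hrd, hF⟩ := h.support_eq hr.symm hFcard
  -- The `E*_i` are trimmed first: the cyclic vector needs every remaining `E*_i` to be nonzero, and
  -- it then bounds the rank of the `E_i`.
  have h1 := (h.dual.shift hrd fun i hi => (hF i hi).mp).dual
  have hF0 : ∀ i ≤ d, restr W (dualIdempotent G x (r + i)) ≠ 0 := fun i hi =>
    (hF _ (by omega)).mpr (by omega)
  have hF1 : ∀ i ≤ d, RankLEOne (restr W (dualIdempotent G x (r + i))) := fun i hi =>
    hrank _ (by omega)
  obtain ⟨w, hw⟩ : ∃ w, restr W (dualIdempotent G x (r + 0)) w ≠ 0 := by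
    by_contra! hc
    exact hF0 0 (Nat.zero_le _) (LinearMap.ext hc)
  have hu : restr W (dualIdempotent G x (r + 0)) (restr W (dualIdempotent G x (r + 0)) w) =
      restr W (dualIdempotent G x (r + 0)) w := by
    simpa using IsTridiagonalSystem.mul_apply_eq h1.eigen_dual (Nat.zero_le d) (Nat.zero_le d) w
  have hEcard : {i | i ≤ G.diam ∧ restr W (E i) ≠ 0}.ncard = d + 1 := by
    rw [h.eigen.finrank_eq fun i hi => h1.rankLEOne hu hw hF0 hF1 hi, ← hcard, hFcard]
  obtain ⟨htd, hEt⟩ := h.dual.support_eq ht.symm hEcard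
  exact ⟨htd, _, h1.shift htd fun i hi => (hEt i hi).mp,
    fun i hi => (hEt _ (by omega)).mpr (by omega), hF0, hF1, hu, hw⟩

theorem coe_splitVec (hA : ∀ w ∈ W, adj G *ᵥ w ∈ W) (s : ℕ → ℂ) (u : W) (i : ℕ) :
    ((splitVec (restr W (adj G)) s u i : W) : V → ℂ) = aeval (adj G) (splitPoly s i) *ᵥ u :=
  restr_aeval hA _ _

/-- The eigenvalue of `(A - s_{i-1})(A* - s*_i)` on the span of the `i`-th split vector. -/
theorem IsLeonardSystem.eigenvalueOn_eq_split {d : ℕ} {As F₀ : Matrix V V ℂ}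
    {E' F : ℕ → End ℂ W} {s ss : ℕ → ℂ} {u : W}
    (h : IsLeonardSystem d (restr W (adj G)) (restr W As) E' F s ss u)
    (hA : ∀ w ∈ W, adj G *ᵥ w ∈ W) (hAs : ∀ w ∈ W, As *ᵥ w ∈ W) (hF : ∀ w ∈ W, F₀ *ᵥ w ∈ W)
    (hF₀ : F 0 = restr W F₀) {i : ℕ} (hi : i < d) :
    eigenvalueOn ((adj G - s i • (1 : Matrix V V ℂ)) * (As - ss (i + 1) • (1 : Matrix V V ℂ)))
      (img (aeval (adj G) (splitPoly s (i + 1))) (img F₀ W)) =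
      split (restr W (adj G)) (restr W As) s ss u (i + 1) := by
  have hAv := congrArg (Subtype.val : W → V → ℂ) (map_splitVec (restr W (adj G)) s u i)
  have hAsv := congrArg (Subtype.val : W → V → ℂ) (h.map_splitVec_dual hi)
  have hne := h.splitVec_ne_zero h.vec_mem h.vec_ne h.ne_zero_dual h.rank_dual
    (show i + 1 ≤ d by omega)
  rw [restr_apply hA, Submodule.coe_add, Submodule.coe_smul] at hAv
  rw [restr_apply hAs, Submodule.coe_add, Submodule.coe_smul, Submodule.coe_smul] at hAsv
  have hmem : ∀ v ∈ img (aeval (adj G) (splitPoly s (i + 1))) (img F₀ W),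
      ∃ c : ℂ, v = c • ((splitVec (restr W (adj G)) s u (i + 1) : W) : V → ℂ) := by
    rintro _ ⟨_, ⟨w, hw, rfl⟩, rfl⟩
    have hu0 : F 0 u ≠ 0 := by
      rw [h.vec_mem]
      exact h.vec_ne
    obtain ⟨c, hc⟩ := h.rank_dual 0 (Nat.zero_le d) u ⟨w, hw⟩ hu0
    rw [h.vec_mem, hF₀] at hc
    have hc := congrArg (Subtype.val : W → V → ℂ) hc
    rw [restr_apply hF, Submodule.coe_smul] at hc
    refine ⟨c, ?_⟩
    simp only [mulVecLin_apply]
    rw [hc, coe_splitVec hA, mulVec_smul]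
  refine eigenvalueOn_eq ?_ ?_
  · intro hbot
    apply hne
    apply Subtype.ext
    have : ((splitVec (restr W (adj G)) s u (i + 1) : W) : V → ℂ) ∈
        img (aeval (adj G) (splitPoly s (i + 1))) (img F₀ W) := by
      refine ⟨u, ⟨u, u.2, ?_⟩, (coe_splitVec hA s u (i + 1)).symm⟩
      have := congrArg (Subtype.val : W → V → ℂ) h.vec_mem
      rwa [hF₀, restr_apply hF] at this
    rw [hbot] at this
    simpa using this
  · intro v hv
    obtain ⟨c, rfl⟩ := hmem v hv
    rw [mulVec_smul, smul_comm]
    congr 1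
    -- `As - ss (i + 1)` sends the split vector of index `i + 1` to `split` times that of index `i`,
    -- and `adj G - s i` carries the latter back up.
    rw [← mulVec_mulVec, sub_mulVec As, smul_mulVec, one_mulVec, hAsv, add_sub_cancel_left,
      mulVec_smul, sub_mulVec, hAv, smul_mulVec, one_mulVec, add_sub_cancel_left]

/-- An isomorphism of `T`-modules intertwines the actions of `T`. -/
theorem Iso.exists_equiv (h : Iso G x W W') (hW : IsTModule G x W) (hW' : IsTModule G x W') :
    ∃ σ : W ≃ₗ[ℂ] W', ∀ B ∈ terwilliger G x, restr W' B = σ.conj (restr W B) := by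
  obtain ⟨σ, hσ⟩ := h
  refine ⟨σ, fun B hB => ?_⟩
  ext1 w
  apply Subtype.ext
  have := hσ B hB (σ.symm w) (restr W B (σ.symm w)) (restr_apply (hW B hB) _)
  rw [restr_apply (hW' B hB), LinearEquiv.conj_apply_apply, this, σ.apply_symm_apply]

theorem iso_of_equiv (hG : IsDistanceRegular G) (hE : IsIdempotentOrdering G E)
    (hQ : IsQPolynomial G E) (hD : 1 ≤ G.diam) (hW : IsTModule G x W) (hW' : IsTModule G x W')
    (σ : W ≃ₗ[ℂ] W') (hA : ∀ w, σ (restr W (adj G) w) = restr W' (adj G) (σ w))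
    (hAs : ∀ w, σ (restr W (dualAdj x E) w) = restr W' (dualAdj x E) (σ w)) :
    Iso G x W W' := by
  refine ⟨σ, fun B hB => ?_⟩
  have hAT := adj_mem_terwilliger G x
  have hAsT := dualAdj_mem_terwilliger hG hE hQ hD x
  have hle := (terwilliger_eq_adjoin hG hE hQ hD x).ge
  rw [terwilliger_eq_adjoin hG hE hQ hD] at hB
  induction hB using Algebra.adjoin_induction with
  | mem B hB =>
    intro w w₁ h
    rcases hB with rfl | rfl
    · have h1 : w₁ = restr W (adj G) w := Subtype.ext (h.trans (restr_apply (hW _ hAT) w).symm)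
      rw [h1, hA, restr_apply (hW' _ hAT)]
    · have h1 : w₁ = restr W (dualAdj x E) w :=
        Subtype.ext (h.trans (restr_apply (hW _ hAsT) w).symm)
      rw [h1, hAs, restr_apply (hW' _ hAsT)]
  | algebraMap c =>
    intro w w₁ h
    rw [Algebra.algebraMap_eq_smul_one, smul_mulVec, one_mulVec] at h ⊢
    have h1 : w₁ = c • w := Subtype.ext h
    rw [h1, map_smul, Submodule.coe_smul]
  | add B C hB hC h1 h2 =>
    intro w w₁ h
    have h3 : w₁ = ⟨B *ᵥ w, hW B (hle hB) w w.2⟩ + ⟨C *ᵥ w, hW C (hle hC) w w.2⟩ :=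
      Subtype.ext (by rw [h, add_mulVec]; rfl)
    rw [h3, map_add, Submodule.coe_add, h1 w ⟨B *ᵥ w, hW B (hle hB) w w.2⟩ rfl,
      h2 w ⟨C *ᵥ w, hW C (hle hC) w w.2⟩ rfl, add_mulVec]
  | mul B C hB hC h1 h2 =>
    intro w w₁ h
    rw [← mulVec_mulVec] at h
    rw [h1 ⟨C *ᵥ w, hW C (hle hC) w w.2⟩ w₁ h, h2 w ⟨C *ᵥ w, hW C (hle hC) w w.2⟩ rfl,
      mulVec_mulVec]

theorem Iso.endpoint_eq (h : Iso G x W W') (hW : IsTModule G x W) (hW' : IsTModule G x W') :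
    endpoint G x W = endpoint G x W' := by
  obtain ⟨σ, hσ⟩ := h.exists_equiv hW hW'
  rw [endpoint, endpoint, setOf_img_dualIdempotent_ne_bot hW, setOf_img_dualIdempotent_ne_bot hW']
  simp only [hσ _ (dualIdempotent_mem_terwilliger G x _), ne_eq, map_eq_zero_iff _ σ.conj.injective]

theorem Iso.dualEndpoint_eq (h : Iso G x W W') (hE : IsIdempotentOrdering G E)
    (hW : IsTModule G x W) (hW' : IsTModule G x W') :
    dualEndpoint G E W = dualEndpoint G E W' := by
  obtain ⟨σ, hσ⟩ := h.exists_equiv hW hW'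
  rw [dualEndpoint, dualEndpoint, setOf_img_idempotent_ne_bot hE hW,
    setOf_img_idempotent_ne_bot hE hW']
  congr 1
  ext i
  refine and_congr_right fun hi => ?_
  rw [hσ _ (hE.mem_terwilliger x hi), ne_eq, ne_eq, map_eq_zero_iff _ σ.conj.injective]

theorem Iso.traceOn_eq (h : Iso G x W W') (hW : IsTModule G x W) (hW' : IsTModule G x W')
    {B : Matrix V V ℂ} (hB : B ∈ terwilliger G x) : traceOn W B = traceOn W' B := by
  obtain ⟨σ, hσ⟩ := h.exists_equiv hW hW'
  rw [trace_restr, trace_restr, hσ B hB, LinearMap.trace_conj']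

/-- The relations between the eight scalars of a thin irreducible module. -/
theorem IsThinIrreducible.scalar_relations (hW : IsThinIrreducible G x W)
    (hG : IsDistanceRegular G) (hE : IsIdempotentOrdering G E) (hQ : IsQPolynomial G E)
    (hD : 1 ≤ G.diam) {r t d : ℕ} (hr : endpoint G x W = r) (ht : dualEndpoint G E W = t)
    (hd : diameter G x W = d) (hd0 : 0 < d) :
    firstSplit G x E W 1 =
      (dualTheta G x E r - aDualCoeff G x E W 0) * (theta G E (t + 1) - theta G E t) ∧
    firstSplit G x E W 1 =
      (aCoeff G x W 0 - theta G E t) * (dualTheta G x E r - dualTheta G x E (r + 1)) ∧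
    firstSplit G x E W d = (aDualCoeff G x E W d - dualTheta G x E (r + d)) *
      (theta G E (t + d) - theta G E (t + (d - 1))) ∧
    firstSplit G x E W d = (aCoeff G x W d - theta G E (t + d)) *
      (dualTheta G x E (r + d) - dualTheta G x E (r + (d - 1))) ∧
    secondSplit G x E W 1 = (dualTheta G x E r - aDualCoeff G x E W d) *
      (theta G E (t + (d - 1)) - theta G E (t + d)) ∧
    secondSplit G x E W 1 = (aCoeff G x W 0 - theta G E (t + d)) *
      (dualTheta G x E r - dualTheta G x E (r + 1)) ∧
    secondSplit G x E W d = (aDualCoeff G x E W 0 - dualTheta G x E (r + d)) *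
      (theta G E t - theta G E (t + 1)) := by
  obtain ⟨htd, u, h⟩ := hW.exists_isLeonardSystem hG hE hQ hD
  rw [hr, ht, hd] at h
  rw [ht, hd] at htd
  have hAT := adj_mem_terwilliger G x
  have hAsT := dualAdj_mem_terwilliger hG hE hQ hD x
  have hA := hW.isTModule.mulVec_mem hAT
  have hAs := hW.isTModule.mulVec_mem hAsT
  have hFT := fun i => dualIdempotent_mem_terwilliger G x i
  have hF := fun i => hW.isTModule.mulVec_mem (hFT i)
  have ha : ∀ i, aCoeff G x W i =
      LinearMap.trace ℂ W (restr W (dualIdempotent G x (r + i)) * restr W (adj G)) := by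
    intro i
    rw [aCoeff, trace_restr, restr_mul (hF _) hA, hr]
  have hb : ∀ i ≤ d, aDualCoeff G x E W i =
      LinearMap.trace ℂ W (restr W (E (t + i)) * restr W (dualAdj x E)) := by
    intro i hi
    rw [aDualCoeff, trace_restr, ht,
      restr_mul (hW.isTModule.mulVec_mem (hE.mem_terwilliger x (by omega))) hAs]
  have h1 : ∀ i < d, firstSplit G x E W (i + 1) = IsLeonardSystem.split (restr W (adj G))
      (restr W (dualAdj x E)) (fun i => theta G E (t + i))
      (fun i => dualTheta G x E (r + i)) u (i + 1) := by
    intro i hi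
    rw [← h.eigenvalueOn_eq_split hA hAs (hF (r + 0)) rfl hi, firstSplit, splitSpace, tau, hr, ht]
    rfl
  -- The second split sequence is the first split sequence of the reversed system; the index
  -- rewriting below uses that no subtraction is truncated.
  have h2 : ∀ i < d, secondSplit G x E W (i + 1) = IsLeonardSystem.split (restr W (adj G))
      (restr W (dualAdj x E)) (fun i => theta G E (t + (d - i)))
      (fun i => dualTheta G x E (r + i)) u (i + 1) := by
    intro i hi
    rw [← h.reverse.eigenvalueOn_eq_split hA hAs (hF (r + 0)) rfl hi, secondSplit, splitSpaceDown,
      eta, hr, ht, hd, show t + d - (i + 1) + 1 = t + (d - i) by omega, splitPoly,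
      Finset.prod_congr rfl fun j hj => by rw [show t + d - j = t + (d - j) by grind]]
    rfl
  obtain ⟨e, rfl⟩ : ∃ e, d = e + 1 := ⟨d - 1, by omega⟩
  have h10 := h1 0 hd0
  have h1e := h1 e (Nat.lt_succ_self e)
  have h20 := h2 0 hd0
  have h2e := h2 e (Nat.lt_succ_self e)
  simp only [zero_add] at h10 h20
  refine ⟨?_, ?_, ?_, ?_, ?_, ?_, ?_⟩
  · rw [h10, h.split_one hd0, hb 0 (Nat.zero_le _)]
    rfl
  · rw [h10, h.split_one_dual hd0, ha]
    rfl
  · rw [h1e, h.split_last hd0, hb _ le_rfl]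
  · rw [h1e, h.split_last_dual hd0, ha]
  · rw [h20, h.reverse.split_one hd0, hb _ le_rfl]
    rfl
  · rw [h20, h.reverse.split_one_dual hd0, ha]
    rfl
  · rw [h2e, h.reverse.split_last hd0, hb 0 (Nat.zero_le _)]
    simp

theorem iso_of_aDualCoeff_eq (hG : IsDistanceRegular G) (hE : IsIdempotentOrdering G E)
    (hQ : IsQPolynomial G E) (hD : 1 ≤ G.diam) (hW : IsThinIrreducible G x W)
    (hW' : IsThinIrreducible G x W') (hr : endpoint G x W = endpoint G x W')
    (ht : dualEndpoint G E W = dualEndpoint G E W') (hd : diameter G x W = diameter G x W')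
    (h : 0 < diameter G x W' →
      aDualCoeff G x E W (diameter G x W') = aDualCoeff G x E W' (diameter G x W')) :
    Iso G x W W' := by
  obtain ⟨htd, u, hL⟩ := hW.exists_isLeonardSystem hG hE hQ hD
  obtain ⟨htd', u', hL'⟩ := hW'.exists_isLeonardSystem hG hE hQ hD
  rw [hr, ht, hd] at hL
  have hAsT := dualAdj_mem_terwilliger hG hE hQ hD x
  have hET := hE.mem_terwilliger x htd'
  obtain ⟨σ, h1, h2⟩ := hL.exists_equiv_of_trace hL' fun h0 => by
    have := h h0
    rwa [aDualCoeff, aDualCoeff, ht, trace_restr, trace_restr,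
      restr_mul (hW.isTModule.mulVec_mem hET) (hW.isTModule.mulVec_mem hAsT),
      restr_mul (hW'.isTModule.mulVec_mem hET) (hW'.isTModule.mulVec_mem hAsT)] at this
  exact iso_of_equiv hG hE hQ hD hW.isTModule hW'.isTModule σ h1 h2

theorem sub_mul_eq_iff {a b c k : ℂ} (hk : k ≠ 0) : (a - c) * k = (b - c) * k ↔ a = b := by
  rw [mul_left_inj' hk, sub_left_inj]

theorem mul_sub_eq_iff {a b c k : ℂ} (hk : k ≠ 0) : (c - a) * k = (c - b) * k ↔ a = b := by
  rw [mul_left_inj' hk, sub_right_inj]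

/-- Each relation in `scalar_relations` is affine with nonzero slope, and its constants agree for
both modules. The seven equivalences so obtained connect all eight equalities. -/
theorem scalars_tfae (hG : IsDistanceRegular G) (hE : IsIdempotentOrdering G E)
    (hQ : IsQPolynomial G E) (hD : 1 ≤ G.diam) (hW : IsThinIrreducible G x W)
    (hW' : IsThinIrreducible G x W') (hr : endpoint G x W = endpoint G x W')
    (ht : dualEndpoint G E W = dualEndpoint G E W') {d : ℕ} (hd : diameter G x W = d)
    (hd' : diameter G x W' = d) (hd0 : 0 < d) :
    [firstSplit G x E W 1 = firstSplit G x E W' 1,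
      firstSplit G x E W d = firstSplit G x E W' d,
      secondSplit G x E W 1 = secondSplit G x E W' 1,
      secondSplit G x E W d = secondSplit G x E W' d,
      aCoeff G x W 0 = aCoeff G x W' 0,
      aCoeff G x W d = aCoeff G x W' d,
      aDualCoeff G x E W 0 = aDualCoeff G x E W' 0,
      aDualCoeff G x E W d = aDualCoeff G x E W' d].TFAE := by
  obtain ⟨p1, p2, p3, p4, p5, p6, p7⟩ := hW.scalar_relations hG hE hQ hD hr ht hd hd0
  obtain ⟨q1, q2, q3, q4, q5, q6, q7⟩ := hW'.scalar_relations hG hE hQ hD rfl rfl hd' hd0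
  obtain ⟨-, u, h⟩ := hW'.exists_isLeonardSystem hG hE hQ hD
  rw [hd'] at h
  set t := dualEndpoint G E W'
  set r := endpoint G x W'
  have hs : ∀ i ≤ d, ∀ j ≤ d, i ≠ j → theta G E (t + i) - theta G E (t + j) ≠ 0 :=
    fun i hi j hj hij h0 => hij (h.eigen.inj i hi j hj (sub_eq_zero.mp h0))
  have hss : ∀ i ≤ d, ∀ j ≤ d, i ≠ j → dualTheta G x E (r + i) - dualTheta G x E (r + j) ≠ 0 :=
    fun i hi j hj hij h0 => hij (h.eigen_dual.inj i hi j hj (sub_eq_zero.mp h0))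
  have e1 := mul_sub_eq_iff (a := aDualCoeff G x E W 0) (b := aDualCoeff G x E W' 0)
    (c := dualTheta G x E r) (hs 1 hd0 0 (by omega) (by omega))
  have e2 := sub_mul_eq_iff (a := aCoeff G x W 0) (b := aCoeff G x W' 0)
    (c := theta G E t) (hss 0 (by omega) 1 hd0 (by omega))
  have e3 := sub_mul_eq_iff (a := aDualCoeff G x E W d) (b := aDualCoeff G x E W' d)
    (c := dualTheta G x E (r + d)) (hs d le_rfl (d - 1) (by omega) (by omega))
  have e4 := sub_mul_eq_iff (a := aCoeff G x W d) (b := aCoeff G x W' d)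
    (c := theta G E (t + d)) (hss d le_rfl (d - 1) (by omega) (by omega))
  have e5 := mul_sub_eq_iff (a := aDualCoeff G x E W d) (b := aDualCoeff G x E W' d)
    (c := dualTheta G x E r) (hs (d - 1) (by omega) d le_rfl (by omega))
  have e6 := sub_mul_eq_iff (a := aCoeff G x W 0) (b := aCoeff G x W' 0)
    (c := theta G E (t + d)) (hss 0 (by omega) 1 hd0 (by omega))
  have e7 := sub_mul_eq_iff (a := aDualCoeff G x E W 0) (b := aDualCoeff G x E W' 0)
    (c := dualTheta G x E (r + d)) (hs 0 (by omega) 1 hd0 (by omega))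
  rw [add_zero] at e1 e2 e6 e7
  rw [← p1, ← q1] at e1
  rw [← p2, ← q2] at e2
  rw [← p3, ← q3] at e3
  rw [← p4, ← q4] at e4
  rw [← p5, ← q5] at e5
  rw [← p6, ← q6] at e6
  rw [← p7, ← q7] at e7
  tfae_have 1 ↔ 7 := e1
  tfae_have 1 ↔ 5 := e2
  tfae_have 2 ↔ 8 := e3
  tfae_have 2 ↔ 6 := e4
  tfae_have 3 ↔ 8 := e5
  tfae_have 3 ↔ 5 := e6
  tfae_have 4 ↔ 7 := e7
  tfae_finish

/-- The scalar `a*_d` suffices because it recovers the split sequence. Its condition is guarded by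
`0 < d`, so that the case `d = 0` is included. -/
theorem iso_iff (hG : IsDistanceRegular G) (hE : IsIdempotentOrdering G E)
    (hQ : IsQPolynomial G E) (hD : 1 ≤ G.diam) (hW : IsThinIrreducible G x W)
    (hW' : IsThinIrreducible G x W') {d : ℕ} (hd : diameter G x W = d)
    (hd' : diameter G x W' = d) :
    Iso G x W W' ↔ endpoint G x W = endpoint G x W' ∧ dualEndpoint G E W = dualEndpoint G E W' ∧
      (0 < d → aDualCoeff G x E W d = aDualCoeff G x E W' d) := by
  constructor
  · intro h
    have ht := h.dualEndpoint_eq hE hW.isTModule hW'.isTModule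
    refine ⟨h.endpoint_eq hW.isTModule hW'.isTModule, ht, fun _ => ?_⟩
    obtain ⟨htd, -⟩ := hW.exists_isLeonardSystem hG hE hQ hD
    rw [aDualCoeff, aDualCoeff, ← ht]
    refine h.traceOn_eq hW.isTModule hW'.isTModule (mul_mem (hE.mem_terwilliger x ?_)
      (dualAdj_mem_terwilliger hG hE hQ hD x))
    rwa [← hd]
  · rintro ⟨hr, ht, ha⟩
    exact iso_of_aDualCoeff_eq hG hE hQ hD hW hW' hr ht (hd.trans hd'.symm) (by rwa [hd'])

end Module

end DRG

end

theorem mainTheorem11 {V : Type*} [Fintype V] [DecidableEq V]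
    (G : SimpleGraph V) (hG : DRG.IsDistanceRegular G) (hD : 3 ≤ G.diam)
    (E : ℕ → Matrix V V ℂ) (hE : DRG.IsIdempotentOrdering G E) (hQ : DRG.IsQPolynomial G E)
    (x : V) (hk : 3 ≤ (G.neighborSet x).ncard)
    (W W' : Submodule ℂ (V → ℂ))
    (hW : DRG.IsThinIrreducible G x W) (hW' : DRG.IsThinIrreducible G x W')
    (d : ℕ) (hd : DRG.diameter G x W = d) (hd' : DRG.diameter G x W' = d) :
    (d = 0 →
      (DRG.Iso G x W W' ↔
        DRG.endpoint G x W = DRG.endpoint G x W' ∧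
        DRG.dualEndpoint G E W = DRG.dualEndpoint G E W')) ∧
    (0 < d →
      -- isomorphism is equivalent to equality of endpoints, dual endpoints and all eight scalars
      (DRG.Iso G x W W' ↔
        DRG.endpoint G x W = DRG.endpoint G x W' ∧
        DRG.dualEndpoint G E W = DRG.dualEndpoint G E W' ∧
        DRG.firstSplit G x E W 1 = DRG.firstSplit G x E W' 1 ∧
        DRG.firstSplit G x E W d = DRG.firstSplit G x E W' d ∧
        DRG.secondSplit G x E W 1 = DRG.secondSplit G x E W' 1 ∧
        DRG.secondSplit G x E W d = DRG.secondSplit G x E W' d ∧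
        DRG.aCoeff G x W 0 = DRG.aCoeff G x W' 0 ∧
        DRG.aCoeff G x W d = DRG.aCoeff G x W' d ∧
        DRG.aDualCoeff G x E W 0 = DRG.aDualCoeff G x E W' 0 ∧
        DRG.aDualCoeff G x E W d = DRG.aDualCoeff G x E W' d) ∧
      -- any single one of the eight scalars suffices
      (∀ f ∈ ([fun U => DRG.firstSplit G x E U 1, fun U => DRG.firstSplit G x E U d,
          fun U => DRG.secondSplit G x E U 1, fun U => DRG.secondSplit G x E U d,
          fun U => DRG.aCoeff G x U 0, fun U => DRG.aCoeff G x U d,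
          fun U => DRG.aDualCoeff G x E U 0, fun U => DRG.aDualCoeff G x E U d] :
            List (Submodule ℂ (V → ℂ) → ℂ)),
        (DRG.Iso G x W W' ↔
          DRG.endpoint G x W = DRG.endpoint G x W' ∧
          DRG.dualEndpoint G E W = DRG.dualEndpoint G E W' ∧
          f W = f W')) ∧
      -- the eight equalities are equivalent when endpoints and dual endpoints agree
      (DRG.endpoint G x W = DRG.endpoint G x W' →
        DRG.dualEndpoint G E W = DRG.dualEndpoint G E W' →
        [DRG.firstSplit G x E W 1 = DRG.firstSplit G x E W' 1,
          DRG.firstSplit G x E W d = DRG.firstSplit G x E W' d,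
          DRG.secondSplit G x E W 1 = DRG.secondSplit G x E W' 1,
          DRG.secondSplit G x E W d = DRG.secondSplit G x E W' d,
          DRG.aCoeff G x W 0 = DRG.aCoeff G x W' 0,
          DRG.aCoeff G x W d = DRG.aCoeff G x W' d,
          DRG.aDualCoeff G x E W 0 = DRG.aDualCoeff G x E W' 0,
          DRG.aDualCoeff G x E W d = DRG.aDualCoeff G x E W' d].TFAE)) := by
  have hD1 : 1 ≤ G.diam := by omega
  have hiso := DRG.iso_iff hG hE hQ hD1 hW hW' hd hd'
  refine ⟨?_, fun h0 => ⟨?_, ?_, ?_⟩⟩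
  · rintro rfl
    -- For `d = 0` the condition on `a*_d` is vacuous.
    simpa using hiso
  · rw [hiso]
    refine and_congr_right fun hr => and_congr_right fun ht => ?_
    have h := DRG.scalars_tfae hG hE hQ hD1 hW hW' hr ht hd hd' h0
    simp only [h0, forall_const]
    constructor
    · intro ha
      exact ⟨(h.out 0 7).mpr ha, (h.out 1 7).mpr ha, (h.out 2 7).mpr ha, (h.out 3 7).mpr ha,
        (h.out 4 7).mpr ha, (h.out 5 7).mpr ha, (h.out 6 7).mpr ha, ha⟩
    · exact fun ha => ha.2.2.2.2.2.2.2
  · intro f hf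
    rw [hiso]
    refine and_congr_right fun hr => and_congr_right fun ht => ?_
    have h := DRG.scalars_tfae hG hE hQ hD1 hW hW' hr ht hd hd' h0
    simp only [h0, forall_const]
    simp only [List.mem_cons, List.not_mem_nil, or_false] at hf
    rcases hf with rfl | rfl | rfl | rfl | rfl | rfl | rfl | rfl
    · exact h.out 7 0
    · exact h.out 7 1
    · exact h.out 7 2
    · exact h.out 7 3
    · exact h.out 7 4
    · exact h.out 7 5
    · exact h.out 7 6
    · exact h.out 7 7
  · exact fun hr ht => DRG.scalars_tfae hG hE hQ hD1 hW hW' hr ht hd hd' h0
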